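/- Let $\mathcal L=\{R(x,y)\}$ be the language of graphs, let $T$ be the first-order theory of the Rado graph, let $\mathcal U$ be a monster model of $T$ (that is, $\kappa$-saturated and strongly $\kappa$-homogeneous for an uncountable cardinal $\kappa$; "small" means of cardinality $<\kappa$), and let $M\prec\mathcal U$ be a countable elementary submodel. A Keisler measure over $\mathcal U$ is a finitely additive probability measure on the formulas over $\mathcal U$ in a given tuple of variables, modulo equivalence (equivalently, on the sets definable with parameters from $\mathcal U$); it corresponds to a unique regular Borel probability measure on the space of complete types over $\mathcal U$, with which it is identified. For a Borel probability measure $\nu$ on $[0,1]$, let $\mu_\nu$ be the unique $\emptyset$-invariant Keisler measure over $\mathcal U$ in one variable $x$ such that $$\mu_\nu\Big(\bigwedge_{i=1}^n R(x,a_i)\wedge\bigwedge_{j=1}^m\neg R(x,b_j)\Big)=\int_0^1 t^n(1-t)^m\,d\nu(t)$$ for all distinct $a_1,\dots,a_n,b_1,\dots,b_m\in\mathcal U$. For a Keisler measure $\mu$ in one variable that is Borel-definable over $M$ (it is $M$-invariant, and for each $\mathcal L$-formula $\varphi(x,\bar y)$ the map $\mathrm{tp}(\bar b/M)\mapsto\mu(\varphi(x,\bar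 b))$ is Borel), let $\mathbb P_\mu$ be the Keisler measure in the variables $\mathbf x=(x_0,x_1,x_2,\dots)$ whose restriction to the formulas in $x_0,\dots,x_{n-1}$ is $\mu^{(n)}$, where $\mu^{(1)}=\mu(x_0)$, $\mu^{(n+1)}=\mu(x_n)\otimes\mu^{(n)}(x_0,\dots,x_{n-1})$, and $\otimes$ is the Morley product: $(\mu\otimes\lambda)(\varphi(x,\bar y))=\int_{S_{\bar y}(A')}F\,d(\lambda|_{A'})$ with $F(\mathrm{tp}(\bar b/A'))=\mu(\varphi(x,\bar b))$, for any small $A'\prec\mathcal U$ that contains $M$ and the parameters of $\varphi$. Let $S^+_{\mathbf x}(\mathcal U)$ be the set of complete types $p(\mathbf x)$ over $\mathcal U$ with $(x_i\ne x_j)\in p$ for $i\neq j$ and $(x_i=a)\notin p$ for all $i$ and all $a\in\mathcal U$. For $p\in S^+_{\mathbf x}(\mathcal U)$ let $p_{\mathcal L}$ be the isomorphism type of the structure induced on $\{a_0,a_1,\dots\}$ by a realization $(a_0,a_1,\dots)$ of $p$ in an elementary extension of $\mathcal U$. For an $\mathcal L$-structure $N$ let $\mathbb B_N=\{p\in S^+_{\mathbf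 x}(\mathcal U): p_{\mathcal L}\cong N\}$. Let $g$ map $p\in S_{\mathbf x}^+(\mathcal U)$ to the $\mathcal L$-structure on $\mathbb N$ in which $R(i,j)$ holds iff $R(x_i,x_j)\in p$, and let $g_*(\mathbb P_\mu)$ be the push-forward along $g$ of the restriction of $\mathbb P_\mu$ to $S^+_{\mathbf x}(\mathcal U)$, a Borel measure on the space $\mathrm{Str}_{\mathcal L}$ of $\mathcal L$-structures on $\mathbb N$. **Proposition.** Let $0<r<1$ and $\nu=r\delta_1+(1-r)\delta_0$. Then $\mu_\nu$ exists, is unique and is Borel-definable over $M$; $\mathbb P_{\mu_\nu}$ exists and is unique; and: 1. $\mathbb P_{\mu_\nu}(\mathbb B_N)=0$ for every $\mathcal L$-structure $N$. 2. $g_*(\mathbb P_{\mu_\nu})$ is not $\mathrm{Sym}(\mathbb N)$-invariant. 3. The sampled graphs are threshold graphs: for $\varepsilon\in\{0,1\}^{\mathbb N}$ let $G_\varepsilon$ be the graph on $\mathbb N$ in which each vertex $k$ is adjacent to all of $0,\dots,k-1$ if $\varepsilon_k=1$ and to none of them if $\varepsilon_k=0$. Then $g_*(\mathbb P_{\mu_\nu})$-almost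 every structure is of the form $G_\varepsilon$, and $g_*(\mathbb P_{\mu_\nu})$ is the distribution of $G_\varepsilon$ when the $\varepsilon_k$ are independent with $\Pr(\varepsilon_k=1)=r$. -/

import Mathlib

open Set FirstOrder FirstOrder.Language MeasureTheory Cardinal
open scoped NNReal ENNReal

universe u w

set_option linter.unusedSectionVars false

noncomputable section

namespace GenericSampling

/-! ### Type spaces over parameter sets -/

/-- The Borel `σ`-algebra of a space of complete types (with its Stone topology). -/
instance completeTypeMeasurableSpace {L : Language} {T : L.Theory} {α : Type*} :
    MeasurableSpace (T.CompleteType α) := borel _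

instance completeTypeBorelSpace {L : Language} {T : L.Theory} {α : Type*} :
    BorelSpace (T.CompleteType α) := ⟨rfl⟩

section General

variable {L : FirstOrder.Language.{0, 0}} {U : Type u} [L.Structure U]

/-- `S_α(A)`: the complete types over `A ⊆ U` in the variables `(x_i)_{i ∈ α}`, i.e. the complete
types over the theory of `U` with constants for the elements of `A`. -/
abbrev TypeSpace (L : FirstOrder.Language.{0, 0}) {U : Type u} [L.Structure U] (A : Set U)
    (α : Type*) :=
  (L[[A]].completeTheory U).CompleteType α

/-- `tp(b / A)`. -/
def tp (L : FirstOrder.Language.{0, 0}) {U : Type u} [L.Structure U] [Nonempty U]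
    (A : Set U) {α : Type*} (b : α → U) : TypeSpace L A α :=
  (L[[A]].completeTheory U).typeOf b

/-- The `A`-definable subset of `U^α` defined by the formula `ψ(x)` over `A`. (In Mathlib, a
formula in a type over `A` is a sentence in which the variables are new constants.) -/
def definedSet {A : Set U} {α : Type*} (ψ : L[[A]][[α]].Sentence) : L.DefinableSet A α :=
  ⟨{v | (Formula.equivSentence.symm ψ).Realize v}, ⟨_, rfl⟩⟩

/-- `U` is a monster model of `T` with respect to the cardinal `κ`: it is a model of `T`,
it is `κ`-saturated and it is strongly `κ`-homogeneous. A set is called small if its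
cardinality is less than `κ`. -/
structure IsMonsterModel (κ : Cardinal.{u}) (T : L.Theory) (U : Type u) [L.Structure U]
    [Nonempty U] : Prop where
  model : U ⊨ T
  saturated : ∀ A : Set U, #A < κ → ∀ (n : ℕ) (p : TypeSpace L A (Fin n)),
    ∃ b : Fin n → U, tp L A b = p
  homogeneous : ∀ A : Set U, #A < κ → ∀ f : A → U,
    (∀ φ : L.Formula A, φ.Realize (fun a : A => (a : U)) ↔ φ.Realize f) →
    ∃ σ : U ≃[L] U, ∀ a : A, σ a = f a

/-! ### Definable sets -/

/-- An `A`-definable set is `B`-definable for `A ⊆ B`. -/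
def enlarge {A B : Set U} (h : A ⊆ B) {α : Type*} (D : L.DefinableSet A α) :
    L.DefinableSet B α :=
  ⟨(D : Set (α → U)), D.2.mono h⟩

/-- `φ(x, y)` seen as a formula in a larger tuple of variables. -/
def cylinder {A : Set U} {α β : Type*} (f : α → β) (D : L.DefinableSet A α) :
    L.DefinableSet A β :=
  ⟨(fun v : β → U => v ∘ f) ⁻¹' (D : Set (α → U)), D.2.preimage_comp f⟩

theorem definable_fiber {A : Set U} {α β : Type*} {s : Set (α ⊕ β → U)} (hs : A.Definable L s)
    (b : β → U) : (univ : Set U).Definable L {a : α → U | Sum.elim a b ∈ s} := by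
  obtain ⟨φ, rfl⟩ := hs.mono (subset_univ A)
  refine ⟨BoundedFormula.subst φ (Sum.elim Term.var
    (fun j => Constants.term (L.con (⟨b j, trivial⟩ : (univ : Set U))))), ?_⟩
  ext a
  simp only [mem_ofPred_eq, Formula.Realize, BoundedFormula.realize_subst]
  refine iff_of_eq ?_
  congr 1
  ext i
  rcases i with i | j
  · simp
  · simp

/-- For `φ(x, y)` over `A` and a tuple `b` from `U`: the set defined by `φ(x, b)`. -/
def fiber {A : Set U} {α β : Type*} (D : L.DefinableSet A (α ⊕ β)) (b : β → U) :
    L.DefinableSet (univ : Set U) α :=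
  ⟨{a | Sum.elim a b ∈ (D : Set (α ⊕ β → U))}, definable_fiber D.2 b⟩

/-! ### Keisler measures -/

/-- A Keisler measure over `A ⊆ U` in the variables `(x_i)_{i ∈ α}`: a finitely additive
probability measure on the `A`-definable subsets of `U^α`. -/
@[ext]
structure KeislerMeasure (L : FirstOrder.Language.{0, 0}) {U : Type u} [L.Structure U] (A : Set U)
    (α : Type*) where
  toFun : L.DefinableSet A α → ℝ≥0
  map_top : toFun ⊤ = 1
  map_sup : ∀ D E : L.DefinableSet A α, Disjoint D E → toFun (D ⊔ E) = toFun D + toFun E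

instance {A : Set U} {α : Type*} :
    CoeFun (KeislerMeasure L A α) (fun _ => L.DefinableSet A α → ℝ≥0) := ⟨KeislerMeasure.toFun⟩

namespace KeislerMeasure

variable {A B : Set U} {α β : Type*}

theorem mono (μ : KeislerMeasure L A α) {D E : L.DefinableSet A α} (h : D ≤ E) : μ D ≤ μ E := by
  have h1 : D ⊔ (E \ D) = E := sup_sdiff_cancel_right h
  have h2 := μ.map_sup D (E \ D) disjoint_sdiff_self_right
  rw [h1] at h2
  rw [h2]
  exact le_self_add

theorem map_sup_le (μ : KeislerMeasure L A α) (D E : L.DefinableSet A α) :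
    μ (D ⊔ E) ≤ μ D + μ E := by
  have h1 : D ⊔ (E \ D) = D ⊔ E := sup_sdiff_self_right D E
  rw [← h1, μ.map_sup D (E \ D) disjoint_sdiff_self_right]
  gcongr
  exact μ.mono sdiff_le

/-- The restriction `ν|_A` of a Keisler measure over `B ⊇ A`. -/
def restrict (h : A ⊆ B) (ν : KeislerMeasure L B α) : KeislerMeasure L A α where
  toFun D := ν (enlarge h D)
  map_top := ν.map_top
  map_sup D E hDE := by
    refine ν.map_sup (enlarge h D) (enlarge h E) ?_
    rw [disjoint_iff] at hDE ⊢
    have h' := congrArg (enlarge h) hDE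
    exact Subtype.ext (congrArg Subtype.val h')

/-- The restriction of a Keisler measure to the formulas in the variables `(x_{f i})_{i ∈ α}`. -/
def marginal (f : α → β) (ν : KeislerMeasure L A β) : KeislerMeasure L A α where
  toFun D := ν (cylinder f D)
  map_top := ν.map_top
  map_sup D E hDE := by
    refine ν.map_sup (cylinder f D) (cylinder f E) ?_
    rw [disjoint_iff] at hDE ⊢
    have h := congrArg (cylinder f) hDE
    exact Subtype.ext (congrArg Subtype.val h)

variable [Nonempty U]

theorem tp_mem_typesWith (ψ : L[[A]][[α]].Sentence) (v : α → U) :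
    tp L A v ∈ (L[[A]].completeTheory U).typesWith ψ ↔
      v ∈ (definedSet ψ : Set (α → U)) := by
  rw [Theory.CompleteType.mem_typesWith_iff, tp, Theory.CompleteType.mem_typeOf]
  rfl

theorem definedSet_le {ψ χ : L[[A]][[α]].Sentence}
    (h : (L[[A]].completeTheory U).typesWith ψ ⊆ (L[[A]].completeTheory U).typesWith χ) :
    (definedSet ψ : L.DefinableSet A α) ≤ definedSet χ := fun v hv =>
  (tp_mem_typesWith χ v).1 (h ((tp_mem_typesWith ψ v).2 hv))

theorem definedSet_eq {ψ : L[[A]][[α]].Sentence} {D : L.DefinableSet A α}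
    (h : ∀ v : α → U, tp L A v ∈ (L[[A]].completeTheory U).typesWith ψ ↔ v ∈ D) :
    definedSet ψ = D :=
  Subtype.ext (Set.ext fun v => (tp_mem_typesWith ψ v).symm.trans (h v))

theorem definedSet_inf (ψ χ : L[[A]][[α]].Sentence) :
    (definedSet (ψ ⊓ χ) : L.DefinableSet A α) = definedSet ψ ⊓ definedSet χ :=
  definedSet_eq fun v => by
    rw [Theory.CompleteType.typesWith_inf]
    exact and_congr (tp_mem_typesWith ψ v) (tp_mem_typesWith χ v)

theorem definedSet_not (ψ : L[[A]][[α]].Sentence) :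
    (definedSet (∼ψ) : L.DefinableSet A α) = (definedSet ψ)ᶜ :=
  definedSet_eq fun v => by
    rw [Theory.CompleteType.typesWith_not]
    exact not_congr (tp_mem_typesWith ψ v)

theorem definedSet_top : (definedSet ⊤ : L.DefinableSet A α) = ⊤ :=
  definedSet_eq fun v => by
    rw [Theory.CompleteType.typesWith_top]
    exact ⟨fun _ => trivial, fun _ => trivial⟩

theorem exists_separating {K F : Set (TypeSpace L A α)} (hK : IsCompact K) (hF : IsClosed F)
    (hKF : Disjoint K F) : ∃ χ : L[[A]][[α]].Sentence,
      K ⊆ (L[[A]].completeTheory U).typesWith χ ∧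
        F ⊆ (L[[A]].completeTheory U).typesWith (∼χ) := by
  refine hK.induction_on (p := fun K => ∃ χ : L[[A]][[α]].Sentence,
      K ⊆ (L[[A]].completeTheory U).typesWith χ ∧
        F ⊆ (L[[A]].completeTheory U).typesWith (∼χ)) ?_ ?_ ?_ ?_
  · refine ⟨∼⊤, empty_subset _, ?_⟩
    simp [Theory.CompleteType.typesWith_not, Theory.CompleteType.typesWith_top]
  · rintro s t hst ⟨χ, h1, h2⟩
    exact ⟨χ, hst.trans h1, h2⟩
  · rintro s t ⟨χ, h1, h2⟩ ⟨χ', h3, h4⟩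
    refine ⟨∼(∼χ ⊓ ∼χ'), ?_, ?_⟩
    · simp only [Theory.CompleteType.typesWith_not, Theory.CompleteType.typesWith_inf,
        compl_inter, compl_compl]
      exact union_subset_union h1 h3
    · simp only [Theory.CompleteType.typesWith_not, Theory.CompleteType.typesWith_inf,
        compl_compl] at h2 h4 ⊢
      exact subset_inter h2 h4
  · intro p hp
    have hpF : p ∈ Fᶜ := fun h => disjoint_left.1 hKF hp h
    obtain ⟨_, ⟨χ, rfl⟩, h1, h2⟩ :=
      CompleteType.isTopologicalBasis_range_typesWith.exists_subset_of_mem_open hpF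
        hF.isOpen_compl
    refine ⟨_, mem_nhdsWithin_of_mem_nhds
      ((CompleteType.isOpen_typesWith χ).mem_nhds h1), χ, Subset.rfl, ?_⟩
    rw [Theory.CompleteType.typesWith_not]
    exact subset_compl_comm.1 h2

/-- The infimum of the measures of the formulas that contain a given set of types. -/
def outerValue (ν : KeislerMeasure L A α) (K : Set (TypeSpace L A α)) : ℝ≥0 :=
  ⨅ ψ : {ψ : L[[A]][[α]].Sentence // K ⊆ (L[[A]].completeTheory U).typesWith ψ},
    ν (definedSet ψ.1)

theorem outerValue_le (ν : KeislerMeasure L A α) {K : Set (TypeSpace L A α)}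
    {ψ : L[[A]][[α]].Sentence} (h : K ⊆ (L[[A]].completeTheory U).typesWith ψ) :
    ν.outerValue K ≤ ν (definedSet ψ) :=
  ciInf_le (OrderBot.bddBelow _) (⟨ψ, h⟩ : {ψ : L[[A]][[α]].Sentence //
    K ⊆ (L[[A]].completeTheory U).typesWith ψ})

theorem le_outerValue (ν : KeislerMeasure L A α) {K : Set (TypeSpace L A α)} {c : ℝ≥0}
    (h : ∀ ψ : L[[A]][[α]].Sentence, K ⊆ (L[[A]].completeTheory U).typesWith ψ →
      c ≤ ν (definedSet ψ)) : c ≤ ν.outerValue K := by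
  have : Nonempty {ψ : L[[A]][[α]].Sentence // K ⊆ (L[[A]].completeTheory U).typesWith ψ} :=
    ⟨⟨⊤, by rw [Theory.CompleteType.typesWith_top]; exact subset_univ _⟩⟩
  exact le_ciInf fun ψ => h ψ.1 ψ.2

theorem exists_lt_outerValue_add (ν : KeislerMeasure L A α) (K : Set (TypeSpace L A α))
    {ε : ℝ≥0} (hε : 0 < ε) : ∃ ψ : L[[A]][[α]].Sentence,
      K ⊆ (L[[A]].completeTheory U).typesWith ψ ∧ ν (definedSet ψ) < ν.outerValue K + ε := by
  by_contra! h
  exact absurd (ν.le_outerValue h) (not_le.2 (lt_add_of_pos_right _ hε))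

theorem outerValue_sup_le (ν : KeislerMeasure L A α)
    (K₁ K₂ : TopologicalSpace.Compacts (TypeSpace L A α)) :
    ν.outerValue (K₁ ⊔ K₂ : TopologicalSpace.Compacts (TypeSpace L A α)) ≤
      ν.outerValue K₁ + ν.outerValue K₂ := by
  refine le_of_forall_pos_le_add fun ε hε => ?_
  obtain ⟨ψ, h1, h2⟩ := ν.exists_lt_outerValue_add K₁ (half_pos hε)
  obtain ⟨χ, h3, h4⟩ := ν.exists_lt_outerValue_add K₂ (half_pos hε)
  have e : (definedSet (∼(∼ψ ⊓ ∼χ)) : L.DefinableSet A α) = definedSet ψ ⊔ definedSet χ := by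
    rw [definedSet_not, definedSet_inf, definedSet_not, definedSet_not, compl_inf, compl_compl,
      compl_compl]
  calc ν.outerValue (K₁ ⊔ K₂ : TopologicalSpace.Compacts (TypeSpace L A α))
      ≤ ν (definedSet (∼(∼ψ ⊓ ∼χ))) := ν.outerValue_le (by
        simp only [Theory.CompleteType.typesWith_not, Theory.CompleteType.typesWith_inf,
          compl_inter, compl_compl, TopologicalSpace.Compacts.coe_sup]
        exact union_subset_union h1 h3)
    _ ≤ ν (definedSet ψ) + ν (definedSet χ) := by rw [e]; exact ν.map_sup_le _ _
    _ ≤ (ν.outerValue K₁ + ε / 2) + (ν.outerValue K₂ + ε / 2) := add_le_add h2.le h4.le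
    _ = ν.outerValue K₁ + ν.outerValue K₂ + ε := by
        rw [add_add_add_comm, add_halves]

/-- The content on compact sets of types induced by a Keisler measure. -/
def content (ν : KeislerMeasure L A α) : Content (TypeSpace L A α) where
  toFun K := ν.outerValue K
  mono' K₁ K₂ h := ν.le_outerValue fun _ hψ => ν.outerValue_le (h.trans hψ)
  sup_disjoint' K₁ K₂ hd _ h₂ := by
    have hle : ν.outerValue (K₁ ⊔ K₂ : TopologicalSpace.Compacts _) ≤
        ν.outerValue K₁ + ν.outerValue K₂ := ν.outerValue_sup_le K₁ K₂
    refine le_antisymm hle (ν.le_outerValue fun ψ hψ => ?_)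
    obtain ⟨χ, h1, h3⟩ := exists_separating K₁.isCompact h₂ hd
    rw [TopologicalSpace.Compacts.coe_sup, union_subset_iff] at hψ
    have e : (definedSet ψ : L.DefinableSet A α) =
        definedSet (ψ ⊓ χ) ⊔ definedSet (ψ ⊓ ∼χ) := by
      rw [definedSet_inf, definedSet_inf, definedSet_not, sup_inf_inf_compl]
    rw [e, ν.map_sup]
    · refine add_le_add (ν.outerValue_le ?_) (ν.outerValue_le ?_)
      · rw [Theory.CompleteType.typesWith_inf]
        exact subset_inter hψ.1 h1
      · rw [Theory.CompleteType.typesWith_inf]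
        exact subset_inter hψ.2 h3
    · rw [definedSet_inf, definedSet_inf, definedSet_not]
      exact disjoint_compl_right.mono inf_le_right inf_le_right
  sup_le' K₁ K₂ := ν.outerValue_sup_le K₁ K₂

/-- The regular Borel probability measure on `S_α(A)` that corresponds to a Keisler measure. -/
def toMeasure (ν : KeislerMeasure L A α) : Measure (TypeSpace L A α) := ν.content.measure

/-- The measure `ν.toMeasure` extends `ν`. -/
theorem toMeasure_typesWith (ν : KeislerMeasure L A α) (ψ : L[[A]][[α]].Sentence) :
    ν.toMeasure ((L[[A]].completeTheory U).typesWith ψ) = ν (definedSet ψ) := by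
  have ho := CompleteType.isOpen_typesWith (T := L[[A]].completeTheory U) ψ
  have hc : IsCompact ((L[[A]].completeTheory U).typesWith ψ) :=
    (CompleteType.isClosed_typesWith ψ).isCompact
  rw [toMeasure, Content.measure_apply _ ho.measurableSet, Content.outerMeasure_of_isOpen _ _ ho,
    Content.innerContent_of_isCompact _ hc ho]
  refine congrArg ENNReal.ofNNReal (le_antisymm (ν.outerValue_le Subset.rfl) ?_)
  exact ν.le_outerValue fun χ h => ν.mono (definedSet_le h)

instance (ν : KeislerMeasure L A α) : IsProbabilityMeasure ν.toMeasure := by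
  constructor
  rw [← Theory.CompleteType.typesWith_top, toMeasure_typesWith, definedSet_top, ν.map_top]
  rfl

instance (ν : KeislerMeasure L A α) : ν.toMeasure.Regular :=
  inferInstanceAs ν.content.measure.Regular

/-! ### Invariance, Borel definability, Morley products -/

/-- `μ` is `A`-invariant: `μ(φ(x, a)) = μ(φ(x, b))` whenever `φ` is an `L`-formula and the finite
tuples `a`, `b` have the same type over `A`. -/
def IsInvariant (A : Set U) (μ : KeislerMeasure L (univ : Set U) α) : Prop :=
  ∀ (k : ℕ) (D : L.DefinableSet (∅ : Set U) (α ⊕ Fin k)) (a b : Fin k → U),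
    tp L A a = tp L A b → μ (fiber D a) = μ (fiber D b)

open Classical in
/-- The map `F_{μ,A}^φ : S_y(A) → [0,1]`, `F(q) = μ(φ(x, b))` for any `b` in `U` realizing `q`.
(For `A`-invariant `μ`, small `A` and a formula `φ(x, y)` over `A` in a finite tuple `y`, such `b`
exist and the value does not depend on the choice.) -/
def evalMap (A : Set U) (μ : KeislerMeasure L (univ : Set U) α) {B : Set U}
    (D : L.DefinableSet B (α ⊕ β)) (q : TypeSpace L A β) : ℝ :=
  if h : ∃ b : β → U, tp L A b = q then μ (fiber D h.choose) else 0

/-- `μ` is Borel-definable over `A`. -/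
structure IsBorelDefinable (A : Set U) (μ : KeislerMeasure L (univ : Set U) α) : Prop where
  invariant : μ.IsInvariant A
  measurable : ∀ (k : ℕ) (D : L.DefinableSet (∅ : Set U) (α ⊕ Fin k)),
    Measurable (evalMap A μ D)

/-- `ξ(x, y) = μ(x) ⊗ ν(y)`, where `μ` is Borel-definable over the elementary submodel `M`:
`ξ(φ(x, y)) = ∫ F_{μ,A'}^φ dν|_{A'}` for every small elementary submodel `A'` that contains `M`
and the parameters of `φ`. -/
def IsMorleyProduct (κ : Cardinal.{u}) (M : L.ElementarySubstructure U)
    (μ : KeislerMeasure L (univ : Set U) α) (ν : KeislerMeasure L (univ : Set U) β)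
    (ξ : KeislerMeasure L (univ : Set U) (α ⊕ β)) : Prop :=
  ∀ A' : L.ElementarySubstructure U, M ≤ A' → #A' < κ →
    ∀ D : L.DefinableSet (A' : Set U) (α ⊕ β),
      (ξ (enlarge (subset_univ _) D) : ℝ) =
        ∫ q, evalMap (A' : Set U) μ D q ∂(ν.restrict (subset_univ (A' : Set U))).toMeasure

/-- `P = ℙ_μ` as a Keisler measure in the variables `x_0, x_1, x_2, …`: the restriction of `P` to
the formulas in `x_0, …, x_{n-1}` is `μ^{(n)}`, where `μ^{(1)} = μ(x_0)` and
`μ^{(n+1)} = μ(x_n) ⊗ μ^{(n)}(x_0, …, x_{n-1})`. -/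
structure IsSamplingMeasure (κ : Cardinal.{u}) (M : L.ElementarySubstructure U)
    (μ : KeislerMeasure L (univ : Set U) (Fin 1)) (P : KeislerMeasure L (univ : Set U) ℕ) :
    Prop where
  base : P.marginal (Fin.val : Fin 1 → ℕ) = μ
  step : ∀ n : ℕ, 1 ≤ n → IsMorleyProduct κ M μ (P.marginal (Fin.val : Fin n → ℕ))
    (P.marginal (Sum.elim (fun _ : Fin 1 => n) (Fin.val : Fin n → ℕ)))

end KeislerMeasure

/-! ### Types in countably many variables and labeled structures -/

/-- The space `Str_L` of `L`-structures with universe `ℕ`. -/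
def Str (L : FirstOrder.Language.{0, 0}) : Type := L.Structure ℕ

/-- The set `⟦R(i_1, …, i_n)⟧`. -/
def Str.relSet {n : ℕ} (R : L.Relations n) (i : Fin n → ℕ) : Set (Str L) :=
  {S | S.RelMap R i}

/-- The topology of `Str_L` with subbasis `⟦R(i_1, …, i_n)⟧`, `⟦¬R(i_1, …, i_n)⟧`. -/
instance : TopologicalSpace (Str L) :=
  TopologicalSpace.generateFrom
    {s | ∃ (n : ℕ) (R : L.Relations n) (i : Fin n → ℕ),
      s = Str.relSet R i ∨ s = (Str.relSet R i)ᶜ}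

instance : MeasurableSpace (Str L) := borel _

instance : BorelSpace (Str L) := ⟨rfl⟩

/-- The natural action of `Sym(ℕ)`: `σ` is an isomorphism from `S` onto `permute σ S`. -/
def Str.permute (σ : Equiv.Perm ℕ) (S : Str L) : Str L :=
  @Equiv.inducedStructure L ℕ ℕ S σ

/-- `Sym(ℕ)`-invariance of a Borel measure on `Str_L`. -/
def IsSymInvariant (m : Measure (Str L)) : Prop :=
  ∀ B : Set (Str L), MeasurableSet B → ∀ σ : Equiv.Perm ℕ, m B = m (Str.permute σ '' B)

/-- `S⁺_𝐱(U)`: the types `p` with `(x_i ≠ x_j) ∈ p` for `i ≠ j` and `(x_i = a) ∉ p` for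
`a ∈ U`. -/
def nondegenerateTypes (L : FirstOrder.Language.{0, 0}) (U : Type u) [L.Structure U] :
    Set (TypeSpace L (univ : Set U) ℕ) :=
  {p | (∀ i j : ℕ, i ≠ j → Formula.equivSentence
          (∼(Term.equal (Term.var i) (Term.var j)) : L[[(univ : Set U)]].Formula ℕ) ∈ p) ∧
       (∀ (i : ℕ) (a : (univ : Set U)), Formula.equivSentence
          (Term.equal (Term.var i) (L.con a).term : L[[(univ : Set U)]].Formula ℕ) ∉ p)}

/-- The map `g`: the structure `M_p` on `ℕ` with `R(i_1, …, i_n)` iff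
`R(x_{i_1}, …, x_{i_n}) ∈ p`. -/
def labeledStructure [L.IsRelational] (p : TypeSpace L (univ : Set U) ℕ) : Str L where
  funMap f := isEmptyElim f
  RelMap R i := Formula.equivSentence
    (Relations.formula ((L.lhomWithConstants (univ : Set U)).onRelation R)
      (fun k => Term.var (i k)) : L[[(univ : Set U)]].Formula ℕ) ∈ p

/-- The push-forward `g_*(ℙ)` of the restriction of a measure on `S_𝐱(U)` to `S⁺_𝐱(U)`. -/
def pushforward [L.IsRelational] (P : Measure (TypeSpace L (univ : Set U) ℕ)) :
    Measure (Str L) :=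
  (P.restrict (nondegenerateTypes L U)).map labeledStructure

/-- `p_L ≅ N` for a relational language `L`: in some elementary extension `U'` of `U` there is a
realization `(a_0, a_1, …)` of `p` such that `N` is isomorphic to the structure that `U'` induces
on `{a_0, a_1, …}`. -/
def InducedStructureIso (p : TypeSpace L (univ : Set U) ℕ) (N : Type w) [L.Structure N] : Prop :=
  ∃ (U' : Theory.ModelType.{u, 0, u} (L[[(univ : Set U)]].completeTheory U)) (a : ℕ → U'),
    (L[[(univ : Set U)]].completeTheory U).typeOf a = p ∧
    letI : L.Structure U' := (L.lhomWithConstants (univ : Set U)).reduct U'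
    ∃ f : N ↪[L] U', range f = range a

/-- `𝔹_N = {p ∈ S⁺_𝐱(U) : p_L ≅ N}`. -/
def isoTypes (L : FirstOrder.Language.{0, 0}) (U : Type u) [L.Structure U] [Nonempty U]
    (N : Type w) [L.Structure N] : Set (TypeSpace L (univ : Set U) ℕ) :=
  {p | p ∈ nondegenerateTypes L U ∧ InducedStructureIso p N}

end General

/-! ### The Rado graph -/

/-- The Rado graph: for `i < j`, `i` and `j` are adjacent iff the `i`-th binary digit of `j`
is `1`. -/
def radoGraph : SimpleGraph ℕ := SimpleGraph.fromRel (fun i j => j.testBit i = true)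

/-- The theory of the Rado graph. -/
def radoTheory : FirstOrder.Language.graph.Theory :=
  @FirstOrder.Language.completeTheory FirstOrder.Language.graph ℕ radoGraph.structure

section Graph

variable {U : Type u} [FirstOrder.Language.graph.Structure U]

theorem definable_adj (a : U) : (univ : Set U).Definable FirstOrder.Language.graph
    {v : Fin 1 → U | Structure.RelMap adj ![v 0, a]} := by
  refine ⟨Relations.formula₂
    ((FirstOrder.Language.graph.lhomWithConstants (univ : Set U)).onRelation adj)
    (Term.var 0) (FirstOrder.Language.graph.con (⟨a, trivial⟩ : (univ : Set U))).term, ?_⟩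
  ext v
  simp only [mem_ofPred_eq, Formula.realize_rel₂, LHom.map_onRelation]
  simp

/-- The set defined by `R(x, a)`. -/
def adjSet (a : U) : FirstOrder.Language.graph.DefinableSet (univ : Set U) (Fin 1) :=
  ⟨{v | Structure.RelMap adj ![v 0, a]}, definable_adj a⟩

/-- `μ = μ_ν`: the Keisler measure `μ` is `∅`-invariant and
`μ(⋀ R(x, a_i) ∧ ⋀ ¬R(x, b_j)) = ∫ t^n (1 - t)^m dν` for any distinct points
`a_1, …, a_n, b_1, …, b_m`. -/
structure IsAlbertMeasure [Nonempty U] (ν : Measure unitInterval)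
    (μ : KeislerMeasure FirstOrder.Language.graph (univ : Set U) (Fin 1)) : Prop where
  invariant : μ.IsInvariant ∅
  eval : ∀ A B : Finset U, Disjoint A B →
    (μ (A.inf adjSet ⊓ B.inf (fun b => (adjSet b)ᶜ)) : ℝ) =
      ∫ t : unitInterval, (t : ℝ) ^ A.card * (1 - (t : ℝ)) ^ B.card ∂ν

end Graph

/-- The threshold graph on `ℕ` given by `ε`: the vertex `k` is adjacent to all of `0, …, k - 1` if
`ε k` is true, and to none of them otherwise. -/
def thresholdGraph (ε : ℕ → Bool) : SimpleGraph ℕ :=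
  SimpleGraph.fromRel (fun j k => j < k ∧ ε k = true)

/-- The graph `thresholdGraph ε` as a labeled structure. -/
def thresholdStr (ε : ℕ → Bool) : Str FirstOrder.Language.graph := (thresholdGraph ε).structure

end GenericSampling

end

open GenericSampling

/-! Everything is carried by a continuous map from coin sequences to types. Fix `ε : ℕ → Bool` and
call a sequence generic over `A` with coins `ε` if each `v i` is new over `A` and the earlier
points, and adjacent to all of them or to none according to `ε i`. The extension property provides
such sequences over finite `A`, and any two of them have the same quantifier-free diagram over `A`.
By quantifier elimination (`IsRandomGraph.exists_isSupported`) a definable set depends on the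
diagram over finitely many parameters and variables only, so it either holds or fails for all
sufficiently generic sequences with coins `ε`. This yields a complete type `coinType` over any
parameter set, and its dependence on `ε` is continuous because each formula reads finitely many
coins.

The sampling measure `coinKeisler` is the image of the Bernoulli measure, and its first marginal is
`r p₁ + (1 - r) p₀`, with `p₁`, `p₀` the types of a new point adjacent to everything or to nothing.
This marginal is `μ_ν`. Uniqueness: points are null by invariance, so the values on the cones of
`p₁` and `p₀` give lower bounds for a definable set and for its complement that add up to `1`. The
Morley product identity is Fubini for one fresh independent coin
(`genericallyHolds_fiber_iff_update`, `map_update_coinMeasure`). Uniqueness of `ℙ_μ` holds because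
each formula has finitely many variables and its parameters lie in a small elementary submodel.

A generic sequence with coins `ε` induces the threshold graph of `ε`, which gives the law of the
sampled graph. An isomorphism between two threshold graphs forces equal coins at all positive
indices (`eq_of_thresholdGraph_iso`), so an isomorphism class allows at most one tail of coins and
is null. Invariance fails because vertex `2` never distinguishes `0` from `1`, while vertex `0`
distinguishes `1` from `2` with positive probability. -/

noncomputable section

namespace GenericSampling

/-! ### Random graphs and quantifier elimination -/

section RandomGraph

variable {U : Type u} [FirstOrder.Language.graph.Structure U]

/-- The edge relation of a structure in the language of graphs. -/
abbrev Edge (x y : U) : Prop := Structure.RelMap adj ![x, y]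

variable (U) in
/-- A graph with the extension property. -/
structure IsRandomGraph : Prop where
  irrefl : ∀ x : U, ¬ Edge x x
  symm : ∀ x y : U, Edge x y → Edge y x
  ext : ∀ A B : Finset U, Disjoint A B →
    ∃ z, z ∉ A ∧ z ∉ B ∧ (∀ a ∈ A, Edge z a) ∧ ∀ b ∈ B, ¬ Edge z b

/-- Two tuples have the same quantifier-free type over `∅`. -/
def SameDiagram {ι : Type*} (f g : ι → U) : Prop :=
  ∀ i j, (f i = f j ↔ g i = g j) ∧ (Edge (f i) (f j) ↔ Edge (g i) (g j))

theorem SameDiagram.symm {ι : Type*} {f g : ι → U} (h : SameDiagram f g) : SameDiagram g f :=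
  fun i j => ⟨(h i j).1.symm, (h i j).2.symm⟩

theorem SameDiagram.comp {ι κ : Type*} {f g : ι → U} (h : SameDiagram f g) (e : κ → ι) :
    SameDiagram (f ∘ e) (g ∘ e) :=
  fun i j => h (e i) (e j)

theorem IsRandomGraph.edge_comm (hU : IsRandomGraph U) (x y : U) : Edge x y ↔ Edge y x :=
  ⟨hU.symm x y, hU.symm y x⟩

theorem IsRandomGraph.sameDiagram_snoc (hU : IsRandomGraph U) {ι : Type*} {n : ℕ}
    {v w : ι → U} {xs ys : Fin n → U} {x y : U} (h : SameDiagram (Sum.elim v xs) (Sum.elim w ys))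
    (hxy : ∀ i, (x = Sum.elim v xs i ↔ y = Sum.elim w ys i) ∧
      (Edge x (Sum.elim v xs i) ↔ Edge y (Sum.elim w ys i))) :
    SameDiagram (Sum.elim v (Fin.snoc xs x : Fin (n + 1) → U))
      (Sum.elim w (Fin.snoc ys y : Fin (n + 1) → U)) := by
  have key : ∀ i : ι ⊕ Fin (n + 1),
      (Sum.elim v (Fin.snoc xs x : Fin (n + 1) → U) i = x ∧
        Sum.elim w (Fin.snoc ys y : Fin (n + 1) → U) i = y) ∨
      ∃ j, Sum.elim v (Fin.snoc xs x : Fin (n + 1) → U) i = Sum.elim v xs j ∧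
        Sum.elim w (Fin.snoc ys y : Fin (n + 1) → U) i = Sum.elim w ys j := by
    rintro (i | i)
    · exact Or.inr ⟨Sum.inl i, rfl, rfl⟩
    · refine Fin.lastCases ?_ (fun j => ?_) i
      · left; simp
      · right; exact ⟨Sum.inr j, by simp, by simp⟩
  intro i j
  rcases key i with ⟨h1, h2⟩ | ⟨i', h1, h2⟩ <;> rcases key j with ⟨h3, h4⟩ | ⟨j', h3, h4⟩ <;>
    rw [h1, h2, h3, h4]
  · exact ⟨by simp, iff_of_false (hU.irrefl x) (hU.irrefl y)⟩
  · exact hxy j'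
  · rw [eq_comm, eq_comm (b := y), hU.edge_comm, hU.edge_comm _ y]
    exact hxy i'
  · exact h i' j'

/-- The back-and-forth step: a point already in the tuple is matched with its partner, and a new
point is matched by the extension property. -/
theorem IsRandomGraph.exists_extend (hU : IsRandomGraph U) {ι : Type*} [Finite ι] {f g : ι → U}
    (h : SameDiagram f g) (x : U) :
    ∃ y, ∀ i, (x = f i ↔ y = g i) ∧ (Edge x (f i) ↔ Edge y (g i)) := by
  classical
  by_cases hx : ∃ i, x = f i
  · obtain ⟨i, rfl⟩ := hx
    exact ⟨g i, fun j => h i j⟩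
  · push Not at hx
    obtain ⟨_⟩ := nonempty_fintype ι
    -- The entries of `g` are sorted by the adjacency of `x` to the matching entries of `f`. No
    -- point is sorted both ways, since `f` and `g` have the same equalities.
    obtain ⟨z, hA, hB, h1, h2⟩ := hU.ext ((Finset.univ.filter fun i => Edge x (f i)).image g)
      ((Finset.univ.filter fun i => ¬ Edge x (f i)).image g) (by
        rw [Finset.disjoint_left]
        simp only [Finset.mem_image, Finset.mem_filter, Finset.mem_univ, true_and, not_exists,
          not_and, forall_exists_index, and_imp]
        rintro _ i hi rfl j hj hij
        rw [(h j i).1.2 hij] at hj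
        exact hj hi)
    simp only [Finset.mem_image, Finset.mem_filter, Finset.mem_univ, true_and, not_exists,
      not_and, forall_exists_index, and_imp, forall_apply_eq_imp_iff₂] at hA hB h1 h2
    refine ⟨z, fun i => ⟨iff_of_false (hx i) fun hz => ?_, fun hi => h1 i hi,
      fun hz => by_contra fun hi => h2 i hi hz⟩⟩
    by_cases hi : Edge x (f i)
    · exact hA i hi hz.symm
    · exact hB i hi hz.symm

/-- Induction on the formula: terms are variables because the language is relational, and the
quantifier step is back-and-forth. Finiteness of `α` is what the extension property requires. -/
theorem IsRandomGraph.realize_boundedFormula (hU : IsRandomGraph U) {α : Type*} [Finite α]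
    {n : ℕ} (φ : FirstOrder.Language.graph.BoundedFormula α n) {v w : α → U} :
    ∀ {xs ys : Fin n → U}, SameDiagram (Sum.elim v xs) (Sum.elim w ys) →
      (φ.Realize v xs ↔ φ.Realize w ys) := by
  have hterm : ∀ {m : ℕ} (t : FirstOrder.Language.graph.Term (α ⊕ Fin m)), ∃ i,
      ∀ {v : α → U} {xs : Fin m → U}, t.realize (Sum.elim v xs) = Sum.elim v xs i := by
    rintro m (i | ⟨f, _⟩)
    · exact ⟨i, rfl⟩
    · exact isEmptyElim f
  induction φ with
  | falsum => intros; rfl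
  | equal t₁ t₂ =>
    intro xs ys h
    obtain ⟨i, hi⟩ := hterm t₁
    obtain ⟨j, hj⟩ := hterm t₂
    simp only [BoundedFormula.Realize, hi, hj]
    exact (h i j).1
  | @rel n l R ts =>
    intro xs ys h
    cases R
    obtain ⟨i, hi⟩ := hterm (ts 0)
    obtain ⟨j, hj⟩ := hterm (ts 1)
    have e : ∀ (v : α → U) (xs : Fin n → U), (fun k => (ts k).realize (Sum.elim v xs)) =
        ![Sum.elim v xs i, Sum.elim v xs j] := by
      intro v xs
      ext k
      fin_cases k
      · exact hi
      · exact hj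
    simp only [BoundedFormula.Realize, e]
    exact (h i j).2
  | imp φ ψ ihφ ihψ =>
    intro xs ys h
    simp only [BoundedFormula.realize_imp, ihφ h, ihψ h]
  | all φ ih =>
    intro xs ys h
    simp only [BoundedFormula.realize_all]
    constructor
    · intro H y
      obtain ⟨x, hx⟩ := hU.exists_extend h.symm y
      exact (ih (hU.sameDiagram_snoc h fun i => ⟨(hx i).1.symm, (hx i).2.symm⟩)).1 (H x)
    · intro H x
      obtain ⟨y, hy⟩ := hU.exists_extend h x
      exact (ih (hU.sameDiagram_snoc h hy)).2 (H y)

/-- The set `D` is a union of quantifier-free types over `A` in the variables `(x_i)_{i ∈ s}`. -/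
def IsSupported {α : Type*} (D : Set (α → U)) (A : Set U) (s : Set α) : Prop :=
  ∀ v w : α → U, SameDiagram (Sum.elim ((↑) : A → U) fun i : s => v i)
    (Sum.elim ((↑) : A → U) fun i : s => w i) → (v ∈ D ↔ w ∈ D)

/-- Quantifier elimination. -/
theorem IsRandomGraph.exists_isSupported (hU : IsRandomGraph U) {α : Type*} {A : Set U}
    {D : Set (α → U)} (hD : A.Definable FirstOrder.Language.graph D) :
    ∃ (A₀ : Finset U) (s : Finset α), (A₀ : Set U) ⊆ A ∧ IsSupported D A₀ s := by
  classical
  obtain ⟨A₀, hA₀, hD₀⟩ := definable_iff_finitely_definable.1 hD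
  obtain ⟨φ, rfl⟩ := definable_iff_exists_formula_sum.1 hD₀
  refine ⟨A₀, φ.freeVarFinset.toRight, hA₀, fun v w h => ?_⟩
  -- Only the finitely many variables that occur are kept, so that back-and-forth applies although
  -- `α` may be infinite.
  let ψ : FirstOrder.Language.graph.Formula
      (((A₀ : Set U) : Type u) ⊕ ((φ.freeVarFinset.toRight : Set α) : Type _)) :=
    φ.restrictFreeVar fun x => Sum.casesOn (motive := fun y => y ∈ φ.freeVarFinset → _) x.1
      (fun x _ => Sum.inl x) (fun x hx => Sum.inr ⟨x, by simpa using hx⟩) x.2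
  have hψ : ∀ v : α → U, φ.Realize (Sum.elim Subtype.val v) ↔
      ψ.Realize (Sum.elim Subtype.val
        fun i : (φ.freeVarFinset.toRight : Set α) => v i) := fun v => by
    refine (BoundedFormula.realize_restrictFreeVar _ ?_).symm
    rintro ⟨x | x, hx⟩
    · rfl
    · rfl
  simp only [mem_ofPred_eq]
  rw [hψ v, hψ w]
  refine hU.realize_boundedFormula ψ fun i j => ?_
  rcases i with i | i
  · rcases j with j | j
    · exact h i j
    · exact j.elim0
  · exact i.elim0

theorem IsSupported.mono {α : Type*} {D : Set (α → U)} {A A' : Set U} {s s' : Set α}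
    (h : IsSupported D A s) (hA : A ⊆ A') (hs : s ⊆ s') : IsSupported D A' s' := by
  intro v w hvw
  refine h v w ?_
  have h' := hvw.comp (Sum.map (inclusion hA) (inclusion hs))
  rwa [Sum.elim_comp_map, Sum.elim_comp_map] at h'

end RandomGraph

/-! ### Models of the theory of the Rado graph -/

section RadoTheory

theorem radoGraph_adj_of_lt {i j : ℕ} (h : i < j) : radoGraph.Adj j i ↔ j.testBit i = true := by
  -- The reversed clause of `fromRel` is void, since `i < j < 2 ^ j`.
  have hi : i.testBit j = false :=
    Nat.testBit_eq_false_of_lt (h.trans (Nat.lt_pow_self one_lt_two))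
  simp [radoGraph, SimpleGraph.fromRel_adj, h.ne', hi]

theorem radoGraph_extension (A B : Finset ℕ) (hAB : Disjoint A B) :
    ∃ z, z ∉ A ∧ z ∉ B ∧ (∀ a ∈ A, radoGraph.Adj z a) ∧ ∀ b ∈ B, ¬ radoGraph.Adj z b := by
  obtain ⟨N, hN⟩ : ∃ N, ∀ a ∈ A ∪ B, a < N :=
    ⟨(A ∪ B).sup id + 1, fun a ha => Nat.lt_succ_of_le (Finset.le_sup (f := id) ha)⟩
  -- The digits of `z` encode `A`; the extra digit `N` makes `z` larger than all points of `A ∪ B`.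
  let z : ℕ := 2 ^ N + ∑ a ∈ A, 2 ^ a
  have hz : ∀ a, z.testBit a = true ↔ a ∈ insert N A := by
    intro a
    have : z = ∑ a ∈ insert N A, 2 ^ a := by
      rw [Finset.sum_insert fun h => (hN N (Finset.mem_union_left _ h)).false]
    rw [this, ← Nat.mem_bitIndices, ← List.mem_toFinset, Finset.toFinset_bitIndices_sum_two_pow]
  have hlt : ∀ a ∈ A ∪ B, a < z := fun a ha =>
    (hN a ha).trans ((Nat.lt_pow_self one_lt_two).trans_le (Nat.le_add_right _ _))
  refine ⟨z, fun h => (hlt z (Finset.mem_union_left _ h)).false,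
    fun h => (hlt z (Finset.mem_union_right _ h)).false, fun a ha => ?_, fun b hb => ?_⟩
  · rw [radoGraph_adj_of_lt (hlt a (Finset.mem_union_left _ ha)), hz]
    exact Finset.mem_insert_of_mem ha
  · rw [radoGraph_adj_of_lt (hlt b (Finset.mem_union_right _ hb)), hz, Finset.mem_insert]
    rintro (h | h)
    · exact (hN b (Finset.mem_union_right _ hb)).ne h
    · exact Finset.disjoint_left.1 hAB h hb

open Classical in
/-- The extension axiom for `n` points and the pattern `s`. -/
def extensionAxiom (n : ℕ) (s : Fin n → Prop) : FirstOrder.Language.graph.Sentence :=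
  (BoundedFormula.imp
    (BoundedFormula.iInf fun p : Fin n × Fin n => if s p.1 ∧ ¬ s p.2 then
      ∼(Term.bdEqual (Term.var (Sum.inr p.1)) (Term.var (Sum.inr p.2))) else ⊤)
    (BoundedFormula.ex (BoundedFormula.iInf fun i : Fin n =>
      ∼(Term.bdEqual (Term.var (Sum.inr (Fin.last n))) (Term.var (Sum.inr i.castSucc))) ⊓
      if s i then adj.boundedFormula₂ (Term.var (Sum.inr (Fin.last n)))
          (Term.var (Sum.inr i.castSucc))
        else ∼(adj.boundedFormula₂ (Term.var (Sum.inr (Fin.last n)))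
          (Term.var (Sum.inr i.castSucc)))))).alls

theorem realize_extensionAxiom {V : Type*} [FirstOrder.Language.graph.Structure V] {n : ℕ}
    {s : Fin n → Prop} : V ⊨ extensionAxiom n s ↔ ∀ x : Fin n → V,
      (∀ i j, s i → ¬ s j → x i ≠ x j) →
        ∃ z, ∀ i, z ≠ x i ∧ (Structure.RelMap adj ![z, x i] ↔ s i) := by
  classical
  rw [extensionAxiom, Sentence.Realize, BoundedFormula.realize_alls]
  refine forall_congr' fun x => ?_
  rw [BoundedFormula.realize_imp, BoundedFormula.realize_ex]
  refine imp_congr ?_ (exists_congr fun z => ?_)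
  · rw [BoundedFormula.realize_iInf, Prod.forall]
    refine forall₂_congr fun i j => ?_
    split_ifs with h
    · simp [h]
    · simp only [BoundedFormula.realize_top, true_iff]
      exact fun h1 h2 => absurd ⟨h1, h2⟩ h
  · rw [BoundedFormula.realize_iInf]
    refine forall_congr' fun i => ?_
    rw [BoundedFormula.realize_inf]
    refine and_congr (by simp) ?_
    split_ifs with h
    · simp [h]
    · simp [h]

/-- The graph axioms and all extension axioms are first-order sentences true in the Rado graph, so
they belong to its complete theory. -/
theorem isRandomGraph_of_model {U : Type u} [FirstOrder.Language.graph.Structure U]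
    (h : U ⊨ radoTheory) : IsRandomGraph U := by
  classical
  have key : ∀ φ : FirstOrder.Language.graph.Sentence,
      (@Sentence.Realize _ ℕ radoGraph.structure φ) → U ⊨ φ := fun φ hφ =>
    h.realize_of_mem φ hφ
  have hs : U ⊨ Theory.simpleGraph := ⟨fun φ hφ => key φ
    ((simpleGraph_model radoGraph).realize_of_mem φ hφ)⟩
  rw [Theory.simpleGraph_model_iff] at hs
  refine ⟨fun x => hs.1.irrefl x, fun x y => hs.2.symm x y, fun A B hAB => ?_⟩
  have hax := key (extensionAxiom (A ∪ B).card fun i => ((A ∪ B).equivFin.symm i : U) ∈ A) (by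
    let := radoGraph.structure
    rw [realize_extensionAxiom]
    intro x hx
    obtain ⟨z, h1, h2, h3, h4⟩ := radoGraph_extension
      ((Finset.univ.filter fun i => ((A ∪ B).equivFin.symm i : U) ∈ A).image x)
      ((Finset.univ.filter fun i => ((A ∪ B).equivFin.symm i : U) ∉ A).image x) (by
        rw [Finset.disjoint_left]
        simp only [Finset.mem_image, Finset.mem_filter, Finset.mem_univ, true_and, not_exists,
          not_and, forall_exists_index, and_imp]
        rintro _ i hi rfl j hj hij
        exact hx i j hi hj hij.symm)
    simp only [Finset.mem_image, Finset.mem_filter, Finset.mem_univ, true_and, not_exists,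
      not_and, forall_exists_index, and_imp, forall_apply_eq_imp_iff₂] at h1 h2 h3 h4
    refine ⟨z, fun i => ?_⟩
    by_cases hi : ((A ∪ B).equivFin.symm i : U) ∈ A
    · exact ⟨fun hz => h1 i hi hz.symm, iff_of_true (h3 i hi) hi⟩
    · exact ⟨fun hz => h2 i hi hz.symm, iff_of_false (h4 i hi) hi⟩)
  rw [realize_extensionAxiom] at hax
  obtain ⟨z, hz⟩ := hax (fun i => ((A ∪ B).equivFin.symm i : U))
    (fun i j hi hj hij => hj (hij ▸ hi))
  have hz' : ∀ x ∈ A ∪ B, z ≠ x ∧ (Structure.RelMap adj ![z, x] ↔ x ∈ A) := fun x hx => by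
    have := hz ((A ∪ B).equivFin ⟨x, hx⟩)
    simpa using this
  exact ⟨z, fun h => (hz' z (Finset.mem_union_left _ h)).1 rfl,
    fun h => (hz' z (Finset.mem_union_right _ h)).1 rfl,
    fun a ha => (hz' a (Finset.mem_union_left _ ha)).2.2 ha,
    fun b hb hzb => Finset.disjoint_left.1 hAB
      ((hz' b (Finset.mem_union_right _ hb)).2.1 hzb) hb⟩

end RadoTheory

/-! ### Threshold graphs -/

section Threshold

theorem thresholdGraph_adj (ε : ℕ → Bool) (i j : ℕ) :
    (thresholdGraph ε).Adj i j ↔ i ≠ j ∧ ε (max i j) = true := by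
  rw [thresholdGraph, SimpleGraph.fromRel_adj]
  refine and_congr_right fun h => ?_
  rcases lt_or_gt_of_ne h with h | h
  · simp [h, h.le, h.not_gt]
  · simp [h, h.le, h.not_gt]

theorem thresholdGraph_adj_of_lt {ε : ℕ → Bool} {i j : ℕ} (h : i < j) :
    (thresholdGraph ε).Adj i j ↔ ε j = true := by
  rw [thresholdGraph_adj, max_eq_right h.le]
  exact and_iff_right h.ne

theorem thresholdGraph_adj_zero {ε : ℕ → Bool} {i : ℕ} :
    (thresholdGraph ε).Adj 0 i ↔ 0 < i ∧ ε i = true := by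
  rw [thresholdGraph_adj, max_eq_right (Nat.zero_le _), ne_comm, Nat.pos_iff_ne_zero]

/-- The vertices `0` and `v` are twins if the vertices `1, …, v` are of the same kind. -/
theorem thresholdGraph_adj_swap {δ : ℕ → Bool} {v : ℕ} (hv : ∀ i, 0 < i → i ≤ v → δ i = δ v)
    (i j : ℕ) : (thresholdGraph δ).Adj (Equiv.swap 0 v i) (Equiv.swap 0 v j) ↔
      (thresholdGraph δ).Adj i j := by
  have key : ∀ j, j ≠ 0 → j ≠ v → δ (max v j) = δ j := fun j hj hjv => by
    rcases le_total v j with h | h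
    · rw [max_eq_right h]
    · rw [max_eq_left h, hv j (Nat.pos_of_ne_zero hj) h]
  simp only [thresholdGraph_adj, ne_eq, EmbeddingLike.apply_eq_iff_eq]
  refine and_congr_right fun hij => ?_
  by_cases hi0 : i = 0
  · subst hi0
    by_cases hjv : j = v
    · subst hjv; simp
    · rw [Equiv.swap_apply_left, Equiv.swap_apply_of_ne_of_ne (Ne.symm hij) hjv,
        key j (Ne.symm hij) hjv]
      simp
  by_cases hiv : i = v
  · subst hiv
    by_cases hj0 : j = 0
    · subst hj0; simp
    · rw [Equiv.swap_apply_right, Equiv.swap_apply_of_ne_of_ne hj0 (Ne.symm hij),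
        key j hj0 (Ne.symm hij)]
      simp
  rw [Equiv.swap_apply_of_ne_of_ne hi0 hiv]
  by_cases hj0 : j = 0
  · subst hj0
    rw [Equiv.swap_apply_left, max_comm, key i hi0 hiv]; simp
  by_cases hjv : j = v
  · subst hjv
    rw [Equiv.swap_apply_right, max_comm i j, key i hi0 hiv]; simp
  rw [Equiv.swap_apply_of_ne_of_ne hj0 hjv]

/-- The neighbours of a vertex form a clique and its non-neighbours an independent set. -/
def IsSplitAt (G : SimpleGraph ℕ) (v : ℕ) : Prop :=
  (∀ i j, i ≠ j → G.Adj v i → G.Adj v j → G.Adj i j) ∧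
    ∀ i j, i ≠ v → j ≠ v → ¬ G.Adj v i → ¬ G.Adj v j → ¬ G.Adj i j

/-- The coin of a positive vertex records its adjacency to `0`, and an edge is decided by the coin
of its larger end. -/
theorem isSplitAt_zero (ε : ℕ → Bool) : IsSplitAt (thresholdGraph ε) 0 := by
  constructor
  · intro i j hij hi hj
    rw [thresholdGraph_adj_zero] at hi hj
    rw [thresholdGraph_adj]
    refine ⟨hij, ?_⟩
    rcases max_choice i j with h | h <;> rw [h]
    exacts [hi.2, hj.2]
  · intro i j hi0 hj0 hi hj
    rw [thresholdGraph_adj_zero, not_and] at hi hj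
    rw [thresholdGraph_adj, not_and]
    intro _
    rcases max_choice i j with h | h <;> rw [h]
    exacts [hi (Nat.pos_of_ne_zero hi0), hj (Nat.pos_of_ne_zero hj0)]

/-- For `0 < i < v` the vertices `0` and `i` lie on the same side of `v`, as prescribed by `δ v`.
The split then forces or forbids the edge between them, and that edge is decided by `δ i`. -/
theorem IsSplitAt.eq_of_le {δ : ℕ → Bool} {v : ℕ} (h : IsSplitAt (thresholdGraph δ) v) {i : ℕ}
    (h0 : 0 < i) (hi : i ≤ v) : δ i = δ v := by
  rcases hi.eq_or_lt with rfl | hi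
  · rfl
  have e : ∀ j, j < v → ((thresholdGraph δ).Adj v j ↔ δ v = true) := fun j hj => by
    rw [SimpleGraph.adj_comm, thresholdGraph_adj_of_lt hj]
  cases hv : δ v
  · have := h.2 0 i (h0.trans hi).ne hi.ne (by simp [e 0 (h0.trans hi), hv]) (by simp [e i hi, hv])
    simpa [thresholdGraph_adj_of_lt h0] using this
  · have := h.1 0 i h0.ne ((e 0 (h0.trans hi)).2 hv) ((e i hi).2 hv)
    simpa [thresholdGraph_adj_of_lt h0] using this

/-- An isomorphism fixing `0` preserves coins at positive vertices. If `ε 1` were true and `δ 1`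
false, the preimage `w` of `1` would be a later vertex with false coin, hence not adjacent to `1`.
But `f 1` is a later vertex with true coin, hence adjacent to `1 = f w`. -/
theorem apply_one_le_of_iso_fixing_zero {ε δ : ℕ → Bool} {f : ℕ → ℕ} (hf : Function.Bijective f)
    (h : ∀ i j, (thresholdGraph ε).Adj i j ↔ (thresholdGraph δ).Adj (f i) (f j))
    (h0 : f 0 = 0) (h1 : ε 1 = true) : δ 1 = true := by
  by_contra hδ
  have hpos : ∀ i, 0 < i → 0 < f i := fun i hi => Nat.pos_of_ne_zero fun hz =>
    hi.ne' (hf.1 (hz.trans h0.symm))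
  have e : ∀ i, 0 < i → (ε i = true ↔ δ (f i) = true) := fun i hi => by
    have := h 0 i
    rw [h0, thresholdGraph_adj_zero, thresholdGraph_adj_zero] at this
    simpa [hi, hpos i hi] using this
  obtain ⟨w, hw⟩ := hf.2 1
  have hw0 : 0 < w := Nat.pos_of_ne_zero fun hz => by
    rw [hz, h0] at hw; exact zero_ne_one hw
  have hεw : ¬ ε w = true := by rw [e w hw0, hw]; exact hδ
  have hw1 : 1 < w := lt_of_le_of_ne hw0 fun hz => hεw (hz ▸ h1)
  have hf1 : 1 < f 1 := lt_of_le_of_ne (hpos 1 one_pos) fun hz => by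
    rw [hz] at hw
    exact hw1.ne' (hf.1 hw)
  have h2 := h 1 w
  rw [thresholdGraph_adj_of_lt hw1, hw, SimpleGraph.adj_comm, thresholdGraph_adj_of_lt hf1,
    ← e 1 one_pos] at h2
  exact hεw (h2.2 h1)

/-- The image of `0` again splits the graph, so it is a twin of `0`; composing with the
transposition of the twins repairs `f`. -/
theorem exists_iso_fixing_zero {ε δ : ℕ → Bool} {f : ℕ → ℕ} (hf : Function.Bijective f)
    (h : ∀ i j, (thresholdGraph ε).Adj i j ↔ (thresholdGraph δ).Adj (f i) (f j)) :
    ∃ g : ℕ → ℕ, Function.Bijective g ∧ g 0 = 0 ∧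
      ∀ i j, (thresholdGraph ε).Adj i j ↔ (thresholdGraph δ).Adj (g i) (g j) := by
  have hs : IsSplitAt (thresholdGraph δ) (f 0) := by
    have h0 := isSplitAt_zero ε
    constructor
    · intro i j hij hi hj
      obtain ⟨i, rfl⟩ := hf.2 i
      obtain ⟨j, rfl⟩ := hf.2 j
      rw [← h] at *
      exact h0.1 i j (fun e => hij (congrArg f e)) hi hj
    · intro i j hi0 hj0 hi hj
      obtain ⟨i, rfl⟩ := hf.2 i
      obtain ⟨j, rfl⟩ := hf.2 j
      rw [← h] at *
      exact h0.2 i j (fun e => hi0 (congrArg f e)) (fun e => hj0 (congrArg f e)) hi hj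
  refine ⟨Equiv.swap 0 (f 0) ∘ f, (Equiv.bijective _).comp hf, by simp, fun i j => ?_⟩
  rw [h i j]
  exact (thresholdGraph_adj_swap (δ := δ) (v := f 0) (fun _ h1 h2 => hs.eq_of_le h1 h2)
    (f i) (f j)).symm

/-- A threshold graph determines its binary sequence up to the value at `0`. -/
theorem eq_of_thresholdGraph_iso (k : ℕ) : ∀ {ε δ : ℕ → Bool} {f : ℕ → ℕ},
    Function.Bijective f →
    (∀ i j, (thresholdGraph ε).Adj i j ↔ (thresholdGraph δ).Adj (f i) (f j)) →
    ε (k + 1) = δ (k + 1) := by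
  induction k with
  | zero =>
    intro ε δ f hf h
    obtain ⟨f, hf, h0, h⟩ := exists_iso_fixing_zero hf h
    refine Bool.eq_iff_iff.2 ⟨apply_one_le_of_iso_fixing_zero hf h h0, ?_⟩
    let e := Equiv.ofBijective f hf
    have he : ∀ i, f (e.symm i) = i := fun i => e.apply_symm_apply i
    refine apply_one_le_of_iso_fixing_zero e.symm.bijective (fun i j => ?_)
      (e.symm_apply_eq.2 h0.symm)
    rw [h, he, he]
  | succ k ih =>
    intro ε δ f hf h
    obtain ⟨f, hf, h0, h⟩ := exists_iso_fixing_zero hf h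
    -- Deleting the fixed vertex `0` on both sides shifts the coins by one. The subtraction is
    -- harmless since `f` sends positive vertices to positive vertices.
    have hpos : ∀ i, f (i + 1) - 1 + 1 = f (i + 1) := fun i => Nat.sub_add_cancel
      (Nat.pos_of_ne_zero fun hz => i.succ_ne_zero (hf.1 (hz.trans h0.symm)))
    have hshift : ∀ (ε : ℕ → Bool) (i j : ℕ), (thresholdGraph fun n => ε (n + 1)).Adj i j ↔
        (thresholdGraph ε).Adj (i + 1) (j + 1) := fun ε i j => by
      rw [thresholdGraph_adj, thresholdGraph_adj, Nat.add_max_add_right]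
      simp
    refine ih (ε := fun n => ε (n + 1)) (δ := fun n => δ (n + 1)) (f := fun i => f (i + 1) - 1)
      ⟨fun i j hij => ?_, fun j => ?_⟩ fun i j => ?_
    · have : f (i + 1) = f (j + 1) := by rw [← hpos i, ← hpos j]; exact congrArg (· + 1) hij
      exact Nat.succ_injective (hf.1 this)
    · obtain ⟨i, hi⟩ := hf.2 (j + 1)
      cases i with
      | zero => rw [h0] at hi; exact absurd hi.symm j.succ_ne_zero
      | succ i => exact ⟨i, by simp [hi]⟩
    · rw [hshift, hshift, hpos, hpos, h]

end Threshold

/-! ### Generic sequences -/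

section Generic

variable {U : Type u} [FirstOrder.Language.graph.Structure U]

/-- `x` lies outside `B` and is adjacent to all points of `B` if `c` is true, and to none of them
otherwise. -/
def IsCoinGeneric (c : Bool) (B : Set U) (x : U) : Prop :=
  x ∉ B ∧ ∀ b ∈ B, (Edge x b ↔ c = true)

theorem IsCoinGeneric.mono {c : Bool} {B B' : Set U} {x : U} (h : IsCoinGeneric c B' x)
    (hB : B ⊆ B') : IsCoinGeneric c B x :=
  ⟨fun hx => h.1 (hB hx), fun b hb => h.2 b (hB hb)⟩

theorem IsRandomGraph.exists_isCoinGeneric (hU : IsRandomGraph U) (c : Bool) {B : Set U}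
    (hB : B.Finite) : ∃ x, IsCoinGeneric c B x := by
  cases c
  · obtain ⟨z, -, h1, -, h2⟩ := hU.ext ∅ hB.toFinset (Finset.disjoint_empty_left _)
    exact ⟨z, by simpa using h1, fun b hb => by simpa using h2 b (by simpa using hb)⟩
  · obtain ⟨z, h1, -, h2, -⟩ := hU.ext hB.toFinset ∅ (Finset.disjoint_empty_right _)
    exact ⟨z, by simpa using h1, fun b hb => by simpa using h2 b (by simpa using hb)⟩

theorem IsRandomGraph.infinite (hU : IsRandomGraph U) : Infinite U := by
  by_contra h
  rw [not_infinite_iff_finite] at h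
  obtain ⟨x, hx⟩ := hU.exists_isCoinGeneric true (finite_univ (α := U))
  exact hx.1 trivial

/-- Two points generic with the same coin relate in the same way to matching old points. The loose
indexing by `κ` lets the new point enter anywhere in the tuple. -/
theorem IsRandomGraph.sameDiagram_extend (hU : IsRandomGraph U) {ι κ : Type*} {c : Bool}
    {f g : ι → U} (h : SameDiagram f g) {x y : U} (hx : IsCoinGeneric c (range f) x)
    (hy : IsCoinGeneric c (range g) y) {f' g' : κ → U}
    (hfg : ∀ k, (f' k = x ∧ g' k = y) ∨ ∃ i, f' k = f i ∧ g' k = g i) : SameDiagram f' g' := by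
  have hxy : ∀ i, (x = f i ↔ y = g i) ∧ (Edge x (f i) ↔ Edge y (g i)) := fun i =>
    ⟨iff_of_false (fun e => hx.1 ⟨i, e.symm⟩) (fun e => hy.1 ⟨i, e.symm⟩),
      (hx.2 _ ⟨i, rfl⟩).trans (hy.2 _ ⟨i, rfl⟩).symm⟩
  intro i j
  rcases hfg i with ⟨h1, h2⟩ | ⟨i', h1, h2⟩ <;> rcases hfg j with ⟨h3, h4⟩ | ⟨j', h3, h4⟩ <;>
    rw [h1, h2, h3, h4]
  · exact ⟨by simp, iff_of_false (hU.irrefl x) (hU.irrefl y)⟩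
  · exact hxy j'
  · rw [eq_comm, eq_comm (b := y), hU.edge_comm, hU.edge_comm _ y]
    exact hxy i'
  · exact h i' j'

/-- Every `v i` with `i < n` is generic over `A` and the previous points, as prescribed by `ε`. -/
def IsCoinSequence (ε : ℕ → Bool) (A : Set U) (n : ℕ) (v : ℕ → U) : Prop :=
  ∀ i < n, IsCoinGeneric (ε i) (A ∪ v '' Iio i) (v i)

theorem IsCoinSequence.mono {ε : ℕ → Bool} {A A' : Set U} {n n' : ℕ} {v : ℕ → U}
    (h : IsCoinSequence ε A' n' v) (hA : A ⊆ A') (hn : n ≤ n') : IsCoinSequence ε A n v :=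
  fun i hi => (h i (hi.trans_le hn)).mono (union_subset_union_left _ hA)

theorem IsCoinSequence.congr {ε ε' : ℕ → Bool} {A : Set U} {n : ℕ} {v w : ℕ → U}
    (h : IsCoinSequence ε A n v) (hε : ∀ i < n, ε i = ε' i) (hv : ∀ i < n, v i = w i) :
    IsCoinSequence ε' A n w := by
  intro i hi
  rw [← hε i hi, ← hv i hi, ← image_congr fun j (hj : j ∈ Iio i) => hv j (lt_trans hj hi)]
  exact h i hi

theorem IsCoinSequence.succ {ε : ℕ → Bool} {A : Set U} {n : ℕ} {v : ℕ → U}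
    (h : IsCoinSequence ε A n v) (hn : IsCoinGeneric (ε n) (A ∪ v '' Iio n) (v n)) :
    IsCoinSequence ε A (n + 1) v := fun i hi => by
  rcases (Nat.lt_succ_iff.1 hi).eq_or_lt with rfl | hi
  exacts [hn, h i hi]

theorem IsRandomGraph.exists_isCoinSequence (hU : IsRandomGraph U) (ε : ℕ → Bool) {A : Set U}
    (hA : A.Finite) (n : ℕ) : ∃ v, IsCoinSequence ε A n v := by
  induction n with
  | zero =>
    have := hU.infinite
    exact ⟨fun _ => Classical.arbitrary U, fun i hi => absurd hi i.not_lt_zero⟩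
  | succ n ih =>
    obtain ⟨v, hv⟩ := ih
    obtain ⟨x, hx⟩ := hU.exists_isCoinGeneric (ε n) (hA.union ((finite_Iio n).image v))
    have e : ∀ i < n, v i = Function.update v n x i := fun i hi =>
      (Function.update_of_ne hi.ne _ _).symm
    refine ⟨Function.update v n x, (hv.congr (fun _ _ => rfl) e).succ ?_⟩
    rw [Function.update_self, ← image_congr fun j (hj : j ∈ Iio n) => e j hj]
    exact hx

/-- The coins prescribe all equalities and edges, one new point at a time. This is the source of
completeness of the coin types. -/
theorem IsRandomGraph.sameDiagram_of_isCoinSequence (hU : IsRandomGraph U) {ε : ℕ → Bool}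
    {A : Set U} {n : ℕ} {v w : ℕ → U} (hv : IsCoinSequence ε A n v)
    (hw : IsCoinSequence ε A n w) :
    SameDiagram (Sum.elim ((↑) : A → U) fun i : Iio n => v i)
      (Sum.elim ((↑) : A → U) fun i : Iio n => w i) := by
  induction n with
  | zero =>
    rintro (i | ⟨i, hi⟩) (j | ⟨j, hj⟩)
    · exact ⟨Iff.rfl, Iff.rfl⟩
    · exact absurd hj j.not_lt_zero
    · exact absurd hi i.not_lt_zero
    · exact absurd hj j.not_lt_zero
  | succ n ih =>
    have hr : ∀ v : ℕ → U, range (Sum.elim ((↑) : A → U) fun i : Iio n => v i) =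
        A ∪ v '' Iio n := fun v => by
      rw [Sum.elim_range, Subtype.range_coe, image_eq_range]
    refine hU.sameDiagram_extend (c := ε n) (x := v n) (y := w n)
      (ih (hv.mono Subset.rfl n.le_succ) (hw.mono Subset.rfl n.le_succ)) ?_ ?_ ?_
    · rw [hr]; exact hv n n.lt_succ_self
    · rw [hr]; exact hw n n.lt_succ_self
    · rintro (i | ⟨i, hi⟩)
      · exact Or.inr ⟨Sum.inl i, rfl, rfl⟩
      · rcases (Nat.lt_succ_iff.1 hi).eq_or_lt with rfl | hi
        · exact Or.inl ⟨rfl, rfl⟩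
        · exact Or.inr ⟨Sum.inr ⟨i, hi⟩, rfl, rfl⟩

/-! ### Definable sets decided by a coin sequence -/

/-- `D` contains all sufficiently generic sequences with coins `ε`. -/
def GenericallyHolds (ε : ℕ → Bool) (D : Set (ℕ → U)) : Prop :=
  ∃ (A : Finset U) (n : ℕ), ∀ v, IsCoinSequence ε A n v → v ∈ D

/-- A single generic sequence over the support decides the set, since all others have the same
diagram. -/
theorem IsSupported.genericallyHolds_iff (hU : IsRandomGraph U) {ε : ℕ → Bool}
    {D : Set (ℕ → U)} {A : Finset U} {n : ℕ} (hD : IsSupported D (A : Set U) (Iio n))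
    {v : ℕ → U} (hv : IsCoinSequence ε A n v) : GenericallyHolds ε D ↔ v ∈ D := by
  classical
  constructor
  · rintro ⟨B, m, h⟩
    -- A sequence generic over both parameter sets and long enough for both conditions compares `v`
    -- with the witness `B`, `m`.
    obtain ⟨w, hw⟩ := hU.exists_isCoinSequence ε (A ∪ B).finite_toSet (max n m)
    rw [hD v w (hU.sameDiagram_of_isCoinSequence hv
      (hw.mono (Finset.coe_subset.2 Finset.subset_union_left) (le_max_left _ _)))]
    exact h w (hw.mono (Finset.coe_subset.2 Finset.subset_union_right) (le_max_right _ _))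
  · intro h
    exact ⟨A, n, fun w hw => (hD v w (hU.sameDiagram_of_isCoinSequence hv hw)).1 h⟩

theorem IsRandomGraph.exists_isSupported_nat (hU : IsRandomGraph U) {A : Set U}
    {D : Set (ℕ → U)} (hD : A.Definable FirstOrder.Language.graph D) :
    ∃ (A₀ : Finset U) (n : ℕ), (A₀ : Set U) ⊆ A ∧ IsSupported D A₀ (Iio n) := by
  obtain ⟨A₀, s, hA, h⟩ := hU.exists_isSupported hD
  exact ⟨A₀, s.sup id + 1, hA, h.mono Subset.rfl fun i hi =>
    Nat.lt_succ_of_le (Finset.le_sup (f := id) hi)⟩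

theorem genericallyHolds_univ (ε : ℕ → Bool) : GenericallyHolds ε (univ : Set (ℕ → U)) :=
  ⟨∅, 0, fun _ _ => trivial⟩

theorem GenericallyHolds.mono {ε : ℕ → Bool} {D E : Set (ℕ → U)} (h : GenericallyHolds ε D)
    (hDE : D ⊆ E) : GenericallyHolds ε E := by
  obtain ⟨A, n, h⟩ := h
  exact ⟨A, n, fun v hv => hDE (h v hv)⟩

theorem GenericallyHolds.inter {ε : ℕ → Bool} {D E : Set (ℕ → U)} (hD : GenericallyHolds ε D)
    (hE : GenericallyHolds ε E) : GenericallyHolds ε (D ∩ E) := by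
  classical
  obtain ⟨A, n, hD⟩ := hD
  obtain ⟨B, m, hE⟩ := hE
  exact ⟨A ∪ B, max n m, fun v hv =>
    ⟨hD v (hv.mono (Finset.coe_subset.2 Finset.subset_union_left) (le_max_left _ _)),
      hE v (hv.mono (Finset.coe_subset.2 Finset.subset_union_right) (le_max_right _ _))⟩⟩

theorem GenericallyHolds.nonempty (hU : IsRandomGraph U) {ε : ℕ → Bool} {D : Set (ℕ → U)}
    (h : GenericallyHolds ε D) : D.Nonempty := by
  obtain ⟨A, n, h⟩ := h
  obtain ⟨v, hv⟩ := hU.exists_isCoinSequence ε A.finite_toSet n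
  exact ⟨v, h v hv⟩

theorem genericallyHolds_or_compl (hU : IsRandomGraph U) (ε : ℕ → Bool) {A : Set U}
    {D : Set (ℕ → U)} (hD : A.Definable FirstOrder.Language.graph D) :
    GenericallyHolds ε D ∨ GenericallyHolds ε Dᶜ := by
  obtain ⟨A₀, n, -, h⟩ := hU.exists_isSupported_nat hD
  obtain ⟨v, hv⟩ := hU.exists_isCoinSequence ε A₀.finite_toSet n
  have h' : IsSupported Dᶜ (A₀ : Set U) (Iio n) := fun v w hvw => not_congr (h v w hvw)
  rw [h.genericallyHolds_iff hU hv, h'.genericallyHolds_iff hU hv]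
  exact em _

theorem genericallyHolds_compl (hU : IsRandomGraph U) {ε : ℕ → Bool} {A : Set U}
    {D : Set (ℕ → U)} (hD : A.Definable FirstOrder.Language.graph D) :
    GenericallyHolds ε Dᶜ ↔ ¬ GenericallyHolds ε D := by
  refine ⟨fun h h' => ?_, (genericallyHolds_or_compl hU ε hD).resolve_left⟩
  obtain ⟨v, hv⟩ := (h.inter h').nonempty hU
  exact hv.1 hv.2

theorem genericallyHolds_union (hU : IsRandomGraph U) {ε : ℕ → Bool} {A : Set U}
    {D E : Set (ℕ → U)} (hD : A.Definable FirstOrder.Language.graph D) :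
    GenericallyHolds ε (D ∪ E) ↔ GenericallyHolds ε D ∨ GenericallyHolds ε E := by
  refine ⟨fun h => or_iff_not_imp_left.2 fun h' => ?_, ?_⟩
  · rw [← genericallyHolds_compl hU hD] at h'
    exact (h.inter h').mono fun v hv => hv.1.resolve_left hv.2
  · rintro (h | h)
    exacts [h.mono subset_union_left, h.mono subset_union_right]

/-- Only the coins of the finitely many supporting variables matter; hence the dependence on `ε` is
locally constant. -/
theorem exists_genericallyHolds_congr (hU : IsRandomGraph U) {A : Set U} {D : Set (ℕ → U)}
    (hD : A.Definable FirstOrder.Language.graph D) : ∃ n : ℕ, ∀ ε ε' : ℕ → Bool,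
      (∀ i < n, ε i = ε' i) → (GenericallyHolds ε D ↔ GenericallyHolds ε' D) := by
  obtain ⟨A₀, n, -, h⟩ := hU.exists_isSupported_nat hD
  refine ⟨n, fun ε ε' hε => ?_⟩
  obtain ⟨v, hv⟩ := hU.exists_isCoinSequence ε A₀.finite_toSet n
  rw [h.genericallyHolds_iff hU hv, h.genericallyHolds_iff hU (hv.congr hε fun _ _ => rfl)]

theorem isClopen_genericallyHolds (hU : IsRandomGraph U) {A : Set U} {D : Set (ℕ → U)}
    (hD : A.Definable FirstOrder.Language.graph D) :
    IsClopen {ε : ℕ → Bool | GenericallyHolds ε D} := by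
  obtain ⟨n, hn⟩ := exists_genericallyHolds_congr hU hD
  have : IsLocallyConstant fun ε : ℕ → Bool => GenericallyHolds ε D := by
    rw [IsLocallyConstant.iff_exists_open]
    intro ε
    refine ⟨(Iio n).pi fun i => {ε i}, isOpen_set_pi (finite_Iio n) fun _ _ => isOpen_discrete _,
      fun _ _ => rfl, fun ε' hε' => propext (hn ε' ε hε')⟩
  simpa using this.isClopen_fiber True

end Generic

/-! ### Borel measures determined by Keisler measures -/

section MeasureOfKeisler

variable {L : FirstOrder.Language.{0, 0}} {U : Type u} [L.Structure U] [Nonempty U]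

theorem exists_definedSet_eq {A : Set U} {α : Type*} {D : Set (α → U)} (hD : A.Definable L D) :
    ∃ ψ : L[[A]][[α]].Sentence, ((definedSet ψ : L.DefinableSet A α) : Set (α → U)) = D := by
  obtain ⟨φ, rfl⟩ := hD
  refine ⟨Formula.equivSentence φ, ?_⟩
  change {v | (Formula.equivSentence.symm (Formula.equivSentence φ)).Realize v} = _
  rw [Equiv.symm_apply_apply]

theorem tp_eq_iff {A : Set U} {α : Type*} {v w : α → U} :
    tp L A v = tp L A w ↔ ∀ D : Set (α → U), A.Definable L D → (v ∈ D ↔ w ∈ D) := by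
  constructor
  · intro h D hD
    obtain ⟨ψ, rfl⟩ := exists_definedSet_eq hD
    have h1 := KeislerMeasure.tp_mem_typesWith ψ v
    rw [h] at h1
    exact h1.symm.trans (KeislerMeasure.tp_mem_typesWith ψ w)
  · intro h
    refine SetLike.ext fun ψ => ?_
    exact (KeislerMeasure.tp_mem_typesWith ψ v).trans
      ((h _ (definedSet ψ).2).trans (KeislerMeasure.tp_mem_typesWith ψ w).symm)

theorem exists_typesWith_between {A : Set U} {α : Type*} {K V : Set (TypeSpace L A α)}
    (hK : IsCompact K) (hV : IsOpen V) (hKV : K ⊆ V) : ∃ χ : L[[A]][[α]].Sentence,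
      K ⊆ (L[[A]].completeTheory U).typesWith χ ∧ (L[[A]].completeTheory U).typesWith χ ⊆ V := by
  obtain ⟨χ, h1, h2⟩ := KeislerMeasure.exists_separating hK hV.isClosed_compl
    (disjoint_compl_right_iff_subset.2 hKV)
  refine ⟨χ, h1, ?_⟩
  rw [Theory.CompleteType.typesWith_not] at h2
  exact compl_subset_compl.1 h2

/-- Clopen sets need not generate the Borel sets of a type space over a large parameter set, so
regularity is essential: a clopen set fits between a compact set and an open neighbourhood of it. -/
theorem measure_eq_of_typesWith {A : Set U} {α : Type*} {m m' : Measure (TypeSpace L A α)}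
    [IsFiniteMeasure m] [IsFiniteMeasure m'] [m.InnerRegularCompactLTTop]
    [m'.InnerRegularCompactLTTop] (h : ∀ ψ : L[[A]][[α]].Sentence,
      m ((L[[A]].completeTheory U).typesWith ψ) = m' ((L[[A]].completeTheory U).typesWith ψ)) :
    m = m' := by
  have key : ∀ {m m' : Measure (TypeSpace L A α)} [IsFiniteMeasure m]
      [m.InnerRegularCompactLTTop], (∀ ψ : L[[A]][[α]].Sentence,
      m ((L[[A]].completeTheory U).typesWith ψ) = m' ((L[[A]].completeTheory U).typesWith ψ)) →
      ∀ V, IsOpen V → m V ≤ m' V := by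
    intro m m' _ _ h V hV
    refine le_of_forall_lt fun c hc => ?_
    obtain ⟨K, hKV, hK, hcK⟩ := hV.measurableSet.exists_lt_isCompact_of_ne_top
      (measure_ne_top m V) hc
    obtain ⟨χ, h1, h2⟩ := exists_typesWith_between hK hV hKV
    calc c < m K := hcK
      _ ≤ m ((L[[A]].completeTheory U).typesWith χ) := measure_mono h1
      _ = m' ((L[[A]].completeTheory U).typesWith χ) := h χ
      _ ≤ m' V := measure_mono h2
  exact Measure.OuterRegular.ext_isOpen fun V hV =>
    le_antisymm (key h V hV) (key (fun ψ => (h ψ).symm) V hV)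

theorem continuous_of_isClopen_preimage {A : Set U} {α Ω : Type*} [TopologicalSpace Ω]
    {Ψ : Ω → TypeSpace L A α} (h : ∀ ψ : L[[A]][[α]].Sentence, IsOpen {ω | ψ ∈ Ψ ω}) :
    Continuous Ψ := by
  rw [CompleteType.isTopologicalBasis_range_typesWith.continuous_iff]
  rintro _ ⟨ψ, rfl⟩
  exact h ψ

/-- Turns integrals over type spaces into integrals over coin sequences. -/
theorem KeislerMeasure.toMeasure_eq_map {A : Set U} {α Ω : Type*} [TopologicalSpace Ω]
    [MeasurableSpace Ω] [BorelSpace Ω] {π : Measure Ω} [IsFiniteMeasure π]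
    [π.InnerRegularCompactLTTop] {Ψ : Ω → TypeSpace L A α} (hΨ : Continuous Ψ)
    (ν : KeislerMeasure L A α)
    (h : ∀ ψ : L[[A]][[α]].Sentence, π {ω | ψ ∈ Ψ ω} = ν (definedSet ψ)) :
    ν.toMeasure = π.map Ψ := by
  have := Measure.InnerRegularCompactLTTop.map_of_continuous (μ := π) hΨ
  have : IsFiniteMeasure (π.map Ψ) := inferInstance
  refine measure_eq_of_typesWith fun ψ => ?_
  rw [ν.toMeasure_typesWith, Measure.map_apply hΨ.measurable
    (CompleteType.isOpen_typesWith ψ).measurableSet]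
  exact (h ψ).symm

end MeasureOfKeisler

/-! ### Types given by coin sequences -/

section CoinType

variable {U : Type u} [FirstOrder.Language.graph.Structure U] [Nonempty U]

theorem definable_comp {A : Set U} {α : Type*} (f : α → ℕ)
    (D : FirstOrder.Language.graph.DefinableSet A α) :
    A.Definable FirstOrder.Language.graph {v : ℕ → U | v ∘ f ∈ D} :=
  (cylinder f D).2

/-- The type over `A` of `(x_{f i})_i` for a generic sequence `(x_0, x_1, …)` with coins `ε`. -/
def coinType (hU : IsRandomGraph U) (A : Set U) {α : Type*} (f : α → ℕ) (ε : ℕ → Bool) :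
    TypeSpace FirstOrder.Language.graph A α where
  toTheory := {ψ | GenericallyHolds ε {v : ℕ → U |
    v ∘ f ∈ (definedSet ψ : FirstOrder.Language.graph.DefinableSet A α)}}
  subset' ψ hψ := by
    refine (genericallyHolds_univ ε).mono fun v _ => ?_
    refine (KeislerMeasure.tp_mem_typesWith ψ (v ∘ f)).1 ?_
    rw [Theory.CompleteType.typesWith_eq_univ_of_mem_onTheory_lhomWithConstants hψ]
    trivial
  isMaximal' := by
    constructor
    -- By compactness it suffices to treat finitely many sentences; these hold together along an
    -- actual generic sequence in `U`, whose type is satisfiable.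
    · rw [Theory.isSatisfiable_iff_isFinitelySatisfiable]
      intro T hT
      have hT' : GenericallyHolds ε {v : ℕ → U | ∀ ψ ∈ T,
          v ∘ f ∈ (definedSet ψ : FirstOrder.Language.graph.DefinableSet A α)} := by
        classical
        induction T using Finset.induction_on with
        | empty => exact (genericallyHolds_univ ε).mono fun v _ ψ hψ => by simp at hψ
        | insert χ T _ ih =>
          rw [Finset.coe_insert, insert_subset_iff] at hT
          refine (GenericallyHolds.inter hT.1 (ih hT.2)).mono fun v hv ψ hψ => ?_
          rcases Finset.mem_insert.1 hψ with rfl | hψ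
          exacts [hv.1, hv.2 ψ hψ]
      obtain ⟨v, hv⟩ := hT'.nonempty hU
      exact (tp FirstOrder.Language.graph A (v ∘ f)).isMaximal.1.mono fun ψ hψ =>
        (KeislerMeasure.tp_mem_typesWith ψ (v ∘ f)).2 (hv ψ hψ)
    · intro ψ
      rw [mem_ofPred_eq, mem_ofPred_eq]
      refine (genericallyHolds_or_compl hU ε (definable_comp f (definedSet ψ))).imp_right
        fun h => h.mono fun v hv => ?_
      have := KeislerMeasure.definedSet_not (A := A) (U := U)
        (L := FirstOrder.Language.graph) (α := α) ψ
      change v ∘ f ∈ (definedSet (∼ψ) : FirstOrder.Language.graph.DefinableSet A α)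
      rw [this]
      exact hv

theorem mem_coinType (hU : IsRandomGraph U) {A : Set U} {α : Type*} {f : α → ℕ} {ε : ℕ → Bool}
    {ψ : FirstOrder.Language.graph[[A]][[α]].Sentence} : ψ ∈ coinType hU A f ε ↔
      GenericallyHolds ε {v : ℕ → U |
        v ∘ f ∈ (definedSet ψ : FirstOrder.Language.graph.DefinableSet A α)} :=
  Iff.rfl

theorem equivSentence_mem_coinType (hU : IsRandomGraph U) {A : Set U} {α : Type*} {f : α → ℕ}
    {ε : ℕ → Bool} {φ : FirstOrder.Language.graph[[A]].Formula α} :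
    Formula.equivSentence φ ∈ coinType hU A f ε ↔
      GenericallyHolds ε {v : ℕ → U | φ.Realize (v ∘ f)} := by
  rw [mem_coinType]
  have : (definedSet (Formula.equivSentence φ) : FirstOrder.Language.graph.DefinableSet A α) =
      ⟨{v | φ.Realize v}, ⟨φ, rfl⟩⟩ := by
    refine Subtype.ext ?_
    change {v | (Formula.equivSentence.symm (Formula.equivSentence φ)).Realize v} = _
    rw [Equiv.symm_apply_apply]
  rw [this]
  rfl

theorem mem_iff_of_tp_eq_coinType (hU : IsRandomGraph U) {A : Set U} {α : Type*} {f : α → ℕ}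
    {ε : ℕ → Bool} {b : α → U} (hb : tp FirstOrder.Language.graph A b = coinType hU A f ε)
    {D : Set (α → U)} (hD : A.Definable FirstOrder.Language.graph D) :
    b ∈ D ↔ GenericallyHolds ε {v : ℕ → U | v ∘ f ∈ D} := by
  obtain ⟨ψ, rfl⟩ := exists_definedSet_eq hD
  refine (KeislerMeasure.tp_mem_typesWith ψ b).symm.trans ?_
  rw [hb]
  exact mem_coinType hU

theorem continuous_coinType (hU : IsRandomGraph U) (A : Set U) {α : Type*} (f : α → ℕ) :
    Continuous (coinType hU A f) :=
  continuous_of_isClopen_preimage fun ψ =>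
    (isClopen_genericallyHolds hU (definable_comp f (definedSet ψ))).isOpen

/-- Independent coins with parameter `r`. -/
abbrev coinMeasure (r : unitInterval) : Measure (ℕ → Bool) :=
  Measure.infinitePi fun _ : ℕ => ProbabilityTheory.bernoulliMeasure true false r

/-- The Keisler measure of a generic sequence with independent coins. -/
def coinKeisler (hU : IsRandomGraph U) (r : unitInterval) :
    KeislerMeasure FirstOrder.Language.graph (univ : Set U) ℕ where
  toFun D := (coinMeasure r {ε | GenericallyHolds ε (D : Set (ℕ → U))}).toNNReal
  map_top := by
    have : {ε | GenericallyHolds ε ((⊤ : FirstOrder.Language.graph.DefinableSet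
        (univ : Set U) ℕ) : Set (ℕ → U))} = Set.univ :=
      eq_univ_of_forall fun ε => genericallyHolds_univ ε
    rw [this, measure_univ, ENNReal.toNNReal_one]
  map_sup D E hDE := by
    have h : {ε | GenericallyHolds ε ((D ⊔ E : FirstOrder.Language.graph.DefinableSet
        (univ : Set U) ℕ) : Set (ℕ → U))} = {ε | GenericallyHolds ε (D : Set (ℕ → U))} ∪
        {ε | GenericallyHolds ε (E : Set (ℕ → U))} := by
      ext ε
      exact genericallyHolds_union hU D.2
    have hd : Disjoint {ε | GenericallyHolds ε (D : Set (ℕ → U))}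
        {ε | GenericallyHolds ε (E : Set (ℕ → U))} := by
      rw [Set.disjoint_left]
      intro ε h1 h2
      obtain ⟨v, hv1, hv2⟩ := (GenericallyHolds.inter h1 h2).nonempty hU
      have : v ∈ (D ⊓ E : FirstOrder.Language.graph.DefinableSet (univ : Set U) ℕ) := ⟨hv1, hv2⟩
      rw [disjoint_iff.1 hDE] at this
      exact this
    rw [h, measure_union hd (isClopen_genericallyHolds hU E.2).isOpen.measurableSet,
      ENNReal.toNNReal_add (measure_ne_top _ _) (measure_ne_top _ _)]

theorem coe_coinKeisler (hU : IsRandomGraph U) (r : unitInterval)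
    (D : FirstOrder.Language.graph.DefinableSet (univ : Set U) ℕ) :
    (coinKeisler hU r D : ℝ≥0∞) = coinMeasure r {ε | GenericallyHolds ε (D : Set (ℕ → U))} :=
  ENNReal.coe_toNNReal (measure_ne_top _ _)

theorem coinKeisler_toMeasure (hU : IsRandomGraph U) (r : unitInterval) :
    (coinKeisler hU r).toMeasure = (coinMeasure r).map (coinType hU univ id) :=
  KeislerMeasure.toMeasure_eq_map (continuous_coinType hU _ _) _ fun ψ =>
    (coe_coinKeisler hU r (definedSet ψ)).symm

theorem restrict_marginal_coinKeisler_toMeasure (hU : IsRandomGraph U) (r : unitInterval)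
    (A : Set U) {α : Type*} (f : α → ℕ) :
    (((coinKeisler hU r).marginal f).restrict (subset_univ A)).toMeasure =
      (coinMeasure r).map (coinType hU A f) :=
  KeislerMeasure.toMeasure_eq_map (continuous_coinType hU _ _) _ fun ψ =>
    (coe_coinKeisler hU r (cylinder f (enlarge (subset_univ A) (definedSet ψ)))).symm

end CoinType

/-! ### Invariance, Borel definability and the Morley products -/

section Diagram

variable {U : Type u} [FirstOrder.Language.graph.Structure U]

/-- Variables and constants as terms. -/
def paramTerm {A : Set U} {A₀ : Set U} (h : A₀ ⊆ A) {β : Type*} :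
    A₀ ⊕ β → FirstOrder.Language.graph[[A]].Term β :=
  Sum.elim (fun a => (FirstOrder.Language.graph.con (⟨a, h a.2⟩ : A)).term) Term.var

theorem realize_paramTerm {A : Set U} {A₀ : Set U} (h : A₀ ⊆ A) {β : Type*} (b : β → U)
    (i : A₀ ⊕ β) : (paramTerm h i).realize b = Sum.elim ((↑) : A₀ → U) b i := by
  rcases i with a | j
  · simp [paramTerm]
  · rfl

/-- A finite conjunction of atomic formulas and their negations. The values of `f` need not lie in
`A`, since only their pattern of equalities and edges enters. -/
theorem definable_sameDiagram {A A₀ : Set U} (h : A₀ ⊆ A) [Finite A₀] {β : Type*} [Finite β]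
    (f : A₀ ⊕ β → U) : A.Definable FirstOrder.Language.graph
      {b : β → U | SameDiagram f (Sum.elim ((↑) : A₀ → U) b)} := by
  have iff_def : ∀ (p : Prop) (D : Set (β → U)), A.Definable FirstOrder.Language.graph D →
      A.Definable FirstOrder.Language.graph {b | p ↔ b ∈ D} := by
    intro p D hD
    by_cases hp : p
    · simpa [hp] using hD
    · simp only [hp, false_iff]; exact hD.compl
  have : {b : β → U | SameDiagram f (Sum.elim ((↑) : A₀ → U) b)} = ⋂ i, ⋂ j,
      ({b | f i = f j ↔ b ∈ {b : β → U | Sum.elim ((↑) : A₀ → U) b i =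
        Sum.elim ((↑) : A₀ → U) b j}} ∩
      {b | Edge (f i) (f j) ↔ b ∈ {b : β → U | Edge (Sum.elim ((↑) : A₀ → U) b i)
        (Sum.elim ((↑) : A₀ → U) b j)}}) := by
    ext b
    simp [SameDiagram]
  rw [this]
  refine definable_iInter_of_finite fun i => definable_iInter_of_finite fun j =>
    (iff_def _ _ ?_).inter (iff_def _ _ ?_)
  · refine ⟨(paramTerm h i).equal (paramTerm h j), ?_⟩
    ext b
    simp only [mem_ofPred_eq, Formula.realize_equal, realize_paramTerm]
  · refine ⟨Relations.formula₂ ((FirstOrder.Language.graph.lhomWithConstants A).onRelation adj)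
      (paramTerm h i) (paramTerm h j), ?_⟩
    ext b
    simp only [mem_ofPred_eq, Formula.realize_rel₂, LHom.map_onRelation, realize_paramTerm]

theorem sameDiagram_of_tp_eq [Nonempty U] {A A₀ : Set U} (h : A₀ ⊆ A) [Finite A₀] {β : Type*}
    [Finite β] {b b' : β → U}
    (hb : tp FirstOrder.Language.graph A b = tp FirstOrder.Language.graph A b') :
    SameDiagram (Sum.elim ((↑) : A₀ → U) b) (Sum.elim ((↑) : A₀ → U) b') :=
  (tp_eq_iff.1 hb _ (definable_sameDiagram h (Sum.elim ((↑) : A₀ → U) b))).1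
    fun _ _ => ⟨Iff.rfl, Iff.rfl⟩

theorem IsSupported.preimage_comp {α β : Type*} {D : Set (α → U)} {A : Set U} {s : Set α}
    {t : Set β} (h : IsSupported D A s) (f : α → β) (hf : MapsTo f s t) :
    IsSupported {v : β → U | v ∘ f ∈ D} A t := by
  intro v w hvw
  refine h _ _ ?_
  have h' := hvw.comp (Sum.map id fun i : s => (⟨f i, hf i.2⟩ : t))
  rwa [Sum.elim_comp_map, Sum.elim_comp_map] at h'

theorem IsSupported.mem_iff {α : Type*} {D : Set (α → U)} {A : Set U}
    (h : IsSupported D A Set.univ) {v w : α → U}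
    (hvw : SameDiagram (Sum.elim ((↑) : A → U) v) (Sum.elim ((↑) : A → U) w)) :
    v ∈ D ↔ w ∈ D := by
  refine h v w ?_
  have h' := hvw.comp (Sum.map id fun i : (Set.univ : Set α) => (i : α))
  rwa [Sum.elim_comp_map, Sum.elim_comp_map] at h'

theorem IsRandomGraph.exists_isSupported_univ (hU : IsRandomGraph U) {α : Type*} {A : Set U}
    {D : Set (α → U)} (hD : A.Definable FirstOrder.Language.graph D) :
    ∃ A₀ : Finset U, (A₀ : Set U) ⊆ A ∧ IsSupported D A₀ Set.univ := by
  obtain ⟨A₀, s, hA, h⟩ := hU.exists_isSupported hD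
  exact ⟨A₀, hA, h.mono Subset.rfl (subset_univ _)⟩

theorem range_sumElim_coe {β : Type*} (A : Set U) (b : β → U) :
    range (Sum.elim ((↑) : A → U) b) = A ∪ range b := by
  rw [Sum.elim_range, Subtype.range_coe]

theorem isCoinSequence_one {ε : ℕ → Bool} {A : Set U} {x : U} (hx : IsCoinGeneric (ε 0) A x) :
    IsCoinSequence ε A 1 fun _ => x := by
  intro i hi
  obtain rfl := Nat.lt_one_iff.1 hi
  refine hx.mono ?_
  rintro a (ha | ⟨j, hj, -⟩)
  exacts [ha, absurd hj j.not_lt_zero]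

/-- The fiber is supported on `A₀` together with the entries of `b`, so one point generic over these
decides it. -/
theorem genericallyHolds_fiber_iff (hU : IsRandomGraph U) {B : Set U} {β : Type*} [Finite β]
    (D : FirstOrder.Language.graph.DefinableSet B (Fin 1 ⊕ β)) {A₀ : Finset U}
    (hD : IsSupported (D : Set (Fin 1 ⊕ β → U)) (A₀ : Set U) Set.univ) {b : β → U}
    {ε : ℕ → Bool} {x : U}
    (hx : IsCoinGeneric (ε 0) (range (Sum.elim ((↑) : ↥(A₀ : Set U) → U) b)) x) :
    GenericallyHolds ε {v : ℕ → U | v ∘ (Fin.val : Fin 1 → ℕ) ∈ fiber D b} ↔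
      Sum.elim (fun _ => x) b ∈ (D : Set (Fin 1 ⊕ β → U)) := by
  rw [range_sumElim_coe] at hx
  obtain ⟨A₁, hA₁⟩ := (A₀.finite_toSet.union (finite_range b)).exists_finset_coe
  rw [← hA₁] at hx
  have hs : IsSupported {v : ℕ → U | v ∘ (Fin.val : Fin 1 → ℕ) ∈ fiber D b} (A₁ : Set U)
      (Iio 1) := by
    intro v w hvw
    refine hD.mem_iff ?_
    have h0 : ∀ a : (A₀ : Set U), (a : U) ∈ (A₁ : Set U) := fun a => hA₁ ▸ Or.inl a.2
    have h1 : ∀ j : β, b j ∈ (A₁ : Set U) := fun j => hA₁ ▸ Or.inr ⟨j, rfl⟩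
    -- Reindexing that turns the entries of `b` from values of variables into parameters.
    let e : (A₀ : Set U) ⊕ (Fin 1 ⊕ β) → (A₁ : Set U) ⊕ Iio 1 :=
      Sum.elim (fun a => Sum.inl ⟨a, h0 a⟩) (Sum.elim (fun k => Sum.inr ⟨k, k.2⟩)
        fun j => Sum.inl ⟨b j, h1 j⟩)
    have he : ∀ v : ℕ → U, Sum.elim ((↑) : ↥(A₀ : Set U) → U)
        (Sum.elim (v ∘ (Fin.val : Fin 1 → ℕ)) b) =
        (Sum.elim ((↑) : ↥(A₁ : Set U) → U) fun i : Iio 1 => v i) ∘ e := by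
      intro v
      ext (i | i | i) <;> rfl
    rw [he, he]
    exact hvw.comp e
  rw [hs.genericallyHolds_iff hU (isCoinSequence_one hx)]
  rfl

theorem IsRandomGraph.sameDiagram_cons (hU : IsRandomGraph U) {c : Bool} {A : Set U} {β : Type*}
    {b b' : β → U} (h : SameDiagram (Sum.elim ((↑) : A → U) b) (Sum.elim ((↑) : A → U) b'))
    {x y : U} (hx : IsCoinGeneric c (range (Sum.elim ((↑) : A → U) b)) x)
    (hy : IsCoinGeneric c (range (Sum.elim ((↑) : A → U) b')) y) :
    SameDiagram (Sum.elim ((↑) : A → U) (Sum.elim (fun _ : Fin 1 => x) b))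
      (Sum.elim ((↑) : A → U) (Sum.elim (fun _ : Fin 1 => y) b')) := by
  refine hU.sameDiagram_extend h hx hy ?_
  rintro (a | k | j)
  · exact Or.inr ⟨Sum.inl a, rfl, rfl⟩
  · exact Or.inl ⟨rfl, rfl⟩
  · exact Or.inr ⟨Sum.inr j, rfl, rfl⟩

end Diagram

/-! ### Measures of fibers and the Fubini argument for the Morley product -/

section Sampling

variable {U : Type u} [FirstOrder.Language.graph.Structure U] [Nonempty U]

/-- The first marginal of the measure of a generic sequence. -/
abbrev coinKeisler₁ (hU : IsRandomGraph U) (r : unitInterval) :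
    KeislerMeasure FirstOrder.Language.graph (univ : Set U) (Fin 1) :=
  (coinKeisler hU r).marginal Fin.val

theorem coe_coinKeisler₁ (hU : IsRandomGraph U) (r : unitInterval)
    (D : FirstOrder.Language.graph.DefinableSet (univ : Set U) (Fin 1)) :
    (coinKeisler₁ hU r D : ℝ≥0∞) =
      coinMeasure r {ε | GenericallyHolds ε {v : ℕ → U | v ∘ (Fin.val : Fin 1 → ℕ) ∈ D}} :=
  coe_coinKeisler hU r (cylinder Fin.val D)

/-- For each value of the coin, generic points added to `b` and to `b'` give the same diagram, so
the two fibers hold for exactly the same coin sequences. -/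
theorem coinKeisler₁_fiber_eq (hU : IsRandomGraph U) (r : unitInterval) {B : Set U} {β : Type*}
    [Finite β] (D : FirstOrder.Language.graph.DefinableSet B (Fin 1 ⊕ β)) {A₀ : Finset U}
    (hD : IsSupported (D : Set (Fin 1 ⊕ β → U)) (A₀ : Set U) Set.univ) {b b' : β → U}
    (h : SameDiagram (Sum.elim ((↑) : ↥(A₀ : Set U) → U) b)
      (Sum.elim ((↑) : ↥(A₀ : Set U) → U) b')) :
    coinKeisler₁ hU r (fiber D b) = coinKeisler₁ hU r (fiber D b') := by
  rw [← ENNReal.coe_inj, coe_coinKeisler₁, coe_coinKeisler₁]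
  congr 1
  ext ε
  obtain ⟨x, hx⟩ := hU.exists_isCoinGeneric (ε 0)
    (finite_range (Sum.elim ((↑) : ↥(A₀ : Set U) → U) b))
  obtain ⟨y, hy⟩ := hU.exists_isCoinGeneric (ε 0)
    (finite_range (Sum.elim ((↑) : ↥(A₀ : Set U) → U) b'))
  rw [mem_ofPred_eq, mem_ofPred_eq, genericallyHolds_fiber_iff hU D hD hx,
    genericallyHolds_fiber_iff hU D hD hy]
  exact hD.mem_iff (hU.sameDiagram_cons h hx hy)

theorem coinKeisler₁_fiber_eq_of_tp_eq (hU : IsRandomGraph U) (r : unitInterval) {A B : Set U}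
    (hBA : B ⊆ A) {β : Type*} [Finite β]
    (D : FirstOrder.Language.graph.DefinableSet B (Fin 1 ⊕ β)) {b b' : β → U}
    (h : tp FirstOrder.Language.graph A b = tp FirstOrder.Language.graph A b') :
    coinKeisler₁ hU r (fiber D b) = coinKeisler₁ hU r (fiber D b') := by
  obtain ⟨A₀, hA₀, hD⟩ := hU.exists_isSupported_univ D.2
  exact coinKeisler₁_fiber_eq hU r D hD (sameDiagram_of_tp_eq (hA₀.trans hBA) h)

theorem coinKeisler₁_isInvariant (hU : IsRandomGraph U) (r : unitInterval) (A : Set U) :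
    (coinKeisler₁ hU r).IsInvariant A :=
  fun _ D _ _ h => coinKeisler₁_fiber_eq_of_tp_eq hU r (empty_subset A) D h

theorem evalMap_tp (hU : IsRandomGraph U) (r : unitInterval) {A B : Set U}
    (hBA : B ⊆ A) {β : Type*} [Finite β]
    (D : FirstOrder.Language.graph.DefinableSet B (Fin 1 ⊕ β)) (b : β → U) :
    KeislerMeasure.evalMap A (coinKeisler₁ hU r) D (tp FirstOrder.Language.graph A b) =
      coinKeisler₁ hU r (fiber D b) := by
  have h : ∃ b', tp FirstOrder.Language.graph A b' = tp FirstOrder.Language.graph A b := ⟨b, rfl⟩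
  rw [KeislerMeasure.evalMap, dif_pos h,
    coinKeisler₁_fiber_eq_of_tp_eq hU r hBA D h.choose_spec]

/-- The value depends only on the diagram of `b` over a finite set, which is a clopen condition.
Realizing all types in `U` keeps the default value `0` of `evalMap` from occurring. -/
theorem continuous_evalMap (hU : IsRandomGraph U) (r : unitInterval) {A B : Set U}
    (hBA : B ⊆ A) {β : Type*} [Finite β]
    (hA : ∀ p : TypeSpace FirstOrder.Language.graph A β,
      ∃ b : β → U, tp FirstOrder.Language.graph A b = p)
    (D : FirstOrder.Language.graph.DefinableSet B (Fin 1 ⊕ β)) :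
    Continuous (KeislerMeasure.evalMap A (coinKeisler₁ hU r) D) := by
  refine IsLocallyConstant.continuous ((IsLocallyConstant.iff_exists_open _).2 fun p => ?_)
  obtain ⟨A₀, hA₀, hD⟩ := hU.exists_isSupported_univ D.2
  obtain ⟨b, rfl⟩ := hA p
  obtain ⟨ψ, hψ⟩ := exists_definedSet_eq (definable_sameDiagram (hA₀.trans hBA)
    (Sum.elim ((↑) : ↥(A₀ : Set U) → U) b))
  refine ⟨_, CompleteType.isOpen_typesWith ψ, ?_, ?_⟩
  · rw [KeislerMeasure.tp_mem_typesWith, hψ]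
    exact fun _ _ => ⟨Iff.rfl, Iff.rfl⟩
  · intro q hq
    obtain ⟨b', rfl⟩ := hA q
    rw [KeislerMeasure.tp_mem_typesWith, hψ] at hq
    rw [evalMap_tp hU r hBA, evalMap_tp hU r hBA, coinKeisler₁_fiber_eq hU r D hD hq]

theorem coinKeisler₁_isBorelDefinable (hU : IsRandomGraph U) (r : unitInterval) {A : Set U}
    (hA : ∀ (k : ℕ) (p : TypeSpace FirstOrder.Language.graph A (Fin k)),
      ∃ b : Fin k → U, tp FirstOrder.Language.graph A b = p) :
    (coinKeisler₁ hU r).IsBorelDefinable A :=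
  ⟨coinKeisler₁_isInvariant hU r A,
    fun k D => (continuous_evalMap hU r (empty_subset A) (hA k) D).measurable⟩

theorem measurable_update_coin (n : ℕ) :
    Measurable fun p : (ℕ → Bool) × (ℕ → Bool) => Function.update p.1 n (p.2 0) := by
  rw [measurable_pi_iff]
  intro i
  by_cases hi : i = n
  · subst hi
    simp only [Function.update_self]
    fun_prop
  · simp only [Function.update_of_ne hi]
    fun_prop

/-- Replacing a coin by an independent one does not change the distribution. -/
theorem map_update_coinMeasure (r : unitInterval) (n : ℕ) :
    ((coinMeasure r).prod (coinMeasure r)).map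
      (fun p : (ℕ → Bool) × (ℕ → Bool) => Function.update p.1 n (p.2 0)) = coinMeasure r := by
  refine Measure.eq_infinitePi _ fun s t ht => ?_
  have hm := measurable_update_coin n
  have h0 : {ε : ℕ → Bool | ε 0 ∈ t n} = Set.pi (({0} : Finset ℕ) : Set ℕ) fun _ => t n := by
    ext ε; simp
  rw [Measure.map_apply hm (MeasurableSet.pi s.countable_toSet fun i _ => ht i)]
  -- On a box, a constraint at `n` moves to the fresh coin as an independent factor of the same
  -- probability; without such a constraint the update is invisible.
  by_cases hn : n ∈ s
  · have : (fun p : (ℕ → Bool) × (ℕ → Bool) => Function.update p.1 n (p.2 0)) ⁻¹'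
        (Set.pi (s : Set ℕ) t) =
        (Set.pi ((s.erase n : Finset ℕ) : Set ℕ) t) ×ˢ {ε : ℕ → Bool | ε 0 ∈ t n} := by
      ext p
      simp only [mem_preimage, Set.mem_pi, Finset.mem_coe, mem_prod, mem_ofPred_eq,
        Finset.mem_erase]
      constructor
      · intro h
        refine ⟨fun i hi => ?_, ?_⟩
        · simpa [Function.update_of_ne hi.1] using h i hi.2
        · simpa using h n hn
      · rintro ⟨h1, h2⟩ i hi
        by_cases hin : i = n
        · subst hin; simpa using h2
        · simpa [Function.update_of_ne hin] using h1 i ⟨hin, hi⟩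
    rw [this, Measure.prod_prod, h0, Measure.infinitePi_pi _ fun i _ => ht i,
      Measure.infinitePi_pi _ fun i _ => ht n, Finset.prod_singleton, mul_comm,
      Finset.mul_prod_erase s
        (fun i => ProbabilityTheory.bernoulliMeasure true false r (t i)) hn]
  · have : (fun p : (ℕ → Bool) × (ℕ → Bool) => Function.update p.1 n (p.2 0)) ⁻¹'
        (Set.pi (s : Set ℕ) t) = (Set.pi (s : Set ℕ) t) ×ˢ Set.univ := by
      ext p
      simp only [mem_preimage, Set.mem_pi, Finset.mem_coe, mem_prod, mem_univ, and_true]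
      refine forall₂_congr fun i hi => ?_
      rw [Function.update_of_ne (fun h : i = n => hn (h ▸ hi))]
    rw [this, Measure.prod_prod, measure_univ, mul_one, Measure.infinitePi_pi _ fun i _ => ht i]

/-- Over the finite support, `b` looks like a generic sequence of length `n`; adding a generic point
with the fresh coin `ε' 0` extends it by coin `n`. This is the combinatorial content of the Morley
product. -/
theorem genericallyHolds_fiber_iff_update (hU : IsRandomGraph U) {A : Set U} {n : ℕ}
    (D : FirstOrder.Language.graph.DefinableSet A (Fin 1 ⊕ Fin n)) {ε ε' : ℕ → Bool}
    {b : Fin n → U}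
    (hb : tp FirstOrder.Language.graph A b = coinType hU A (Fin.val : Fin n → ℕ) ε) :
    GenericallyHolds ε' {v : ℕ → U | v ∘ (Fin.val : Fin 1 → ℕ) ∈ fiber D b} ↔
      GenericallyHolds (Function.update ε n (ε' 0))
        {v : ℕ → U | v ∘ Sum.elim (fun _ : Fin 1 => n) (Fin.val : Fin n → ℕ) ∈ D} := by
  obtain ⟨A₀, hA₀, hD⟩ := hU.exists_isSupported_univ D.2
  obtain ⟨v, hv⟩ := hU.exists_isCoinSequence ε A₀.finite_toSet n
  -- Having the diagram of `v` over `A₀` is a definable condition over `A` that holds generically,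
  -- so it belongs to the type that `b` realizes.
  have hvb : SameDiagram (Sum.elim ((↑) : ↥(A₀ : Set U) → U) (v ∘ (Fin.val : Fin n → ℕ)))
      (Sum.elim ((↑) : ↥(A₀ : Set U) → U) b) := by
    refine (mem_iff_of_tp_eq_coinType hU hb (definable_sameDiagram hA₀ _)).2
      ⟨A₀, n, fun w hw => ?_⟩
    have h := (hU.sameDiagram_of_isCoinSequence hv hw).comp
      (Sum.map id fun i : Fin n => (⟨i, i.2⟩ : Iio n))
    rwa [Sum.elim_comp_map, Sum.elim_comp_map] at h
  obtain ⟨x, hx⟩ := hU.exists_isCoinGeneric (ε' 0)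
    (finite_range (Sum.elim ((↑) : ↥(A₀ : Set U) → U) b))
  obtain ⟨y, hy⟩ := hU.exists_isCoinGeneric (ε' 0)
    (finite_range (Sum.elim ((↑) : ↥(A₀ : Set U) → U) (v ∘ (Fin.val : Fin n → ℕ))))
  have e : ∀ i < n, v i = Function.update v n y i := fun i hi =>
    (Function.update_of_ne hi.ne _ _).symm
  have hv' : IsCoinSequence (Function.update ε n (ε' 0)) (A₀ : Set U) (n + 1)
      (Function.update v n y) := by
    refine (hv.congr (fun i hi => (Function.update_of_ne hi.ne _ _).symm) e).succ ?_
    rw [Function.update_self, Function.update_self,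
      ← image_congr fun j (hj : j ∈ Iio n) => e j hj]
    refine hy.mono ?_
    rw [range_sumElim_coe]
    refine union_subset_union_right _ ?_
    rintro _ ⟨i, hi, rfl⟩
    exact ⟨⟨i, hi⟩, rfl⟩
  have hs : IsSupported {v : ℕ → U | v ∘ Sum.elim (fun _ : Fin 1 => n) (Fin.val : Fin n → ℕ) ∈
      (D : Set (Fin 1 ⊕ Fin n → U))} (A₀ : Set U) (Iio (n + 1)) := by
    refine hD.preimage_comp _ ?_
    rintro (k | k) -
    · exact n.lt_succ_self
    · exact k.2.trans n.lt_succ_self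
  have hc : Function.update v n y ∘ Sum.elim (fun _ : Fin 1 => n) (Fin.val : Fin n → ℕ) =
      Sum.elim (fun _ => y) (v ∘ (Fin.val : Fin n → ℕ)) := by
    ext (k | k)
    · simp
    · exact (e k k.2).symm
  refine (genericallyHolds_fiber_iff hU D hD hx).trans
    (Iff.trans ?_ (hs.genericallyHolds_iff hU hv').symm)
  rw [mem_ofPred_eq, hc]
  exact (hD.mem_iff (hU.sameDiagram_cons hvb hy hx)).symm

/-- The evaluation map at a coin type is the probability of a section of the updated event; Fubini
integrates the sections, and the updated coins have the original law. -/
theorem coinKeisler_isMorleyProduct (hU : IsRandomGraph U) (r : unitInterval) {κ : Cardinal.{u}}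
    (hκ : ∀ A : Set U, #A < κ → ∀ (n : ℕ) (p : TypeSpace FirstOrder.Language.graph A (Fin n)),
      ∃ b : Fin n → U, tp FirstOrder.Language.graph A b = p)
    (M : FirstOrder.Language.graph.ElementarySubstructure U) (n : ℕ) :
    KeislerMeasure.IsMorleyProduct κ M (coinKeisler₁ hU r)
      ((coinKeisler hU r).marginal (Fin.val : Fin n → ℕ))
      ((coinKeisler hU r).marginal
        (Sum.elim (fun _ : Fin 1 => n) (Fin.val : Fin n → ℕ))) := by
  intro A' _ hA' D
  have hcont := continuous_evalMap hU r Subset.rfl (hκ (A' : Set U) hA' n) D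
  set H : Set (ℕ → Bool) := {ε | GenericallyHolds ε {v : ℕ → U |
    v ∘ Sum.elim (fun _ : Fin 1 => n) (Fin.val : Fin n → ℕ) ∈ D}} with hH
  have hHm : MeasurableSet H :=
    (isClopen_genericallyHolds hU (definable_comp _ D)).isOpen.measurableSet
  have hm := measurable_update_coin n
  have hl : ((coinKeisler hU r).marginal (Sum.elim (fun _ : Fin 1 => n) (Fin.val : Fin n → ℕ))
      (enlarge (subset_univ _) D) : ℝ≥0∞) = coinMeasure r H :=
    coe_coinKeisler hU r (cylinder _ (enlarge (subset_univ _) D))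
  have hr : ∀ ε, KeislerMeasure.evalMap (A' : Set U) (coinKeisler₁ hU r) D
      (coinType hU A' (Fin.val : Fin n → ℕ) ε) =
      (coinMeasure r (Prod.mk ε ⁻¹' ((fun p : (ℕ → Bool) × (ℕ → Bool) =>
        Function.update p.1 n (p.2 0)) ⁻¹' H))).toReal := by
    intro ε
    -- Saturation over the small set `A'` realizes the coin type inside `U`.
    obtain ⟨b, hb⟩ := hκ (A' : Set U) hA' n (coinType hU A' (Fin.val : Fin n → ℕ) ε)
    rw [← hb, evalMap_tp hU r Subset.rfl, ← ENNReal.coe_toReal, coe_coinKeisler₁]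
    congr 2
    ext ε'
    exact genericallyHolds_fiber_iff_update hU D hb
  rw [restrict_marginal_coinKeisler_toMeasure,
    integral_map (continuous_coinType hU _ _).measurable.aemeasurable
      hcont.measurable.aestronglyMeasurable]
  simp only [hr]
  rw [integral_toReal (measurable_measure_prodMk_left (hm hHm)).aemeasurable
    (Filter.Eventually.of_forall fun ε => measure_lt_top _ _), ← Measure.prod_apply (hm hHm),
    ← Measure.map_apply hm hHm, map_update_coinMeasure, ← hl, ENNReal.coe_toReal]

end Sampling

/-! ### The measure `μ_ν` -/

section Albert

variable {U : Type u} [FirstOrder.Language.graph.Structure U] [Nonempty U]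

theorem integral_endpoints (r : unitInterval) (f : unitInterval → ℝ) :
    ∫ t, f t ∂(ENNReal.ofReal r • Measure.dirac (1 : unitInterval) +
      ENNReal.ofReal (1 - r) • Measure.dirac (0 : unitInterval)) = r * f 1 + (1 - r) * f 0 := by
  have hi : ∀ (c : ℝ) (x : unitInterval),
      Integrable f (ENNReal.ofReal c • Measure.dirac x) := fun c x =>
    (integrable_dirac (by simp)).smul_measure ENNReal.ofReal_ne_top
  rw [integral_add_measure (hi _ _) (hi _ _), integral_smul_measure, integral_smul_measure,
    integral_dirac, integral_dirac, ENNReal.toReal_ofReal r.2.1,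
    ENNReal.toReal_ofReal (sub_nonneg.2 r.2.2), smul_eq_mul, smul_eq_mul]

theorem mem_inf_adjSet {A : Finset U} {v : Fin 1 → U} :
    v ∈ A.inf adjSet ↔ ∀ a ∈ A, Edge (v 0) a := by
  classical
  induction A using Finset.induction_on with
  | empty => simp
  | insert a A _ ih =>
    rw [Finset.inf_insert, DefinableSet.mem_inf, ih, Finset.forall_mem_insert]
    rfl

theorem mem_inf_compl_adjSet {A : Finset U} {v : Fin 1 → U} :
    v ∈ A.inf (fun b => (adjSet b)ᶜ) ↔ ∀ a ∈ A, ¬ Edge (v 0) a := by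
  classical
  induction A using Finset.induction_on with
  | empty => simp
  | insert a A _ ih =>
    rw [Finset.inf_insert, DefinableSet.mem_inf, ih, Finset.forall_mem_insert]
    rfl

theorem isAlbertMeasure_coinKeisler₁ (hU : IsRandomGraph U) (r : unitInterval) :
    IsAlbertMeasure (ENNReal.ofReal r • Measure.dirac 1 + ENNReal.ofReal (1 - r) • Measure.dirac 0)
      (coinKeisler₁ hU r) := by
  classical
  refine ⟨coinKeisler₁_isInvariant hU r ∅, fun A B hAB => ?_⟩
  -- Only coin `0` matters: a nonempty `A` forces it to be true, a nonempty `B` forces it to be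
  -- false, and empty families impose nothing.
  have hset : {ε | GenericallyHolds ε {v : ℕ → U | v ∘ (Fin.val : Fin 1 → ℕ) ∈
      A.inf adjSet ⊓ B.inf (fun b => (adjSet b)ᶜ)}} =
      (fun ε : ℕ → Bool => ε 0) ⁻¹' {c | (A.Nonempty → c = true) ∧ (B.Nonempty → c = false)} := by
    ext ε
    have hmem : ∀ v : ℕ → U, v ∘ (Fin.val : Fin 1 → ℕ) ∈
        A.inf adjSet ⊓ B.inf (fun b => (adjSet b)ᶜ) ↔
          (∀ a ∈ A, Edge (v 0) a) ∧ ∀ b ∈ B, ¬ Edge (v 0) b := fun v => by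
      rw [DefinableSet.mem_inf, mem_inf_adjSet, mem_inf_compl_adjSet]
      rfl
    have hgen : ∀ v, IsCoinSequence ε ((A ∪ B : Finset U) : Set U) 1 v →
        ∀ a ∈ A ∪ B, (Edge (v 0) a ↔ ε 0 = true) := fun v hv a ha =>
      (hv 0 one_pos).2 a (Or.inl ha)
    simp only [mem_ofPred_eq, mem_preimage]
    constructor
    · intro h
      have h' : GenericallyHolds ε {v : ℕ → U | IsCoinSequence ε ((A ∪ B : Finset U) : Set U) 1 v} :=
        ⟨A ∪ B, 1, fun v hv => hv⟩
      obtain ⟨v, hv, hv'⟩ := (h.inter h').nonempty hU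
      obtain ⟨h1, h2⟩ := (hmem v).1 hv
      refine ⟨fun ⟨a, ha⟩ => (hgen v hv' a (Finset.mem_union_left _ ha)).1 (h1 a ha),
        fun ⟨b, hb⟩ => ?_⟩
      rw [← Bool.not_eq_true]
      exact fun hε => h2 b hb ((hgen v hv' b (Finset.mem_union_right _ hb)).2 hε)
    · rintro ⟨h1, h2⟩
      refine ⟨A ∪ B, 1, fun v hv => (hmem v).2 ⟨fun a ha => ?_, fun b hb => ?_⟩⟩
      · exact (hgen v hv a (Finset.mem_union_left _ ha)).2 (h1 ⟨a, ha⟩)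
      · rw [hgen v hv b (Finset.mem_union_right _ hb), h2 ⟨b, hb⟩]
        exact Bool.false_ne_true
  rw [integral_endpoints, ← ENNReal.coe_toReal, coe_coinKeisler₁, hset,
    ← Measure.map_apply (measurable_pi_apply 0) (.of_discrete), Measure.infinitePi_map_eval,
    ProbabilityTheory.bernoulliMeasure_apply _ .of_discrete]
  -- The four values are `1`, `1 - r`, `r` and `0`; the convention `0 ^ 0 = 1` accounts for empty
  -- families on the integral side.
  rcases A.eq_empty_or_nonempty with rfl | hA <;> rcases B.eq_empty_or_nonempty with rfl | hB
  · simp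
  · simp [hB, hB.card_ne_zero]
  · simp [hA, hA.card_ne_zero]
  · simp [hA, hB, hA.card_ne_zero, hB.card_ne_zero]

/-! ### Null points and uniqueness of the one-variable measure -/

/-- The definable set `{a}`. -/
def pointSet (a : U) : FirstOrder.Language.graph.DefinableSet (univ : Set U) (Fin 1) :=
  fiber (⟨{v | v (Sum.inl 0) = v (Sum.inr 0)}, (Term.var (Sum.inl 0)).equal
    (Term.var (Sum.inr 0)), by ext; simp⟩ :
      FirstOrder.Language.graph.DefinableSet (∅ : Set U) (Fin 1 ⊕ Fin 1)) fun _ => a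

theorem mem_pointSet {a : U} {v : Fin 1 → U} : v ∈ pointSet a ↔ v 0 = a :=
  Iff.rfl

theorem mem_sup_pointSet {A : Finset U} {v : Fin 1 → U} : v ∈ A.sup pointSet ↔ v 0 ∈ A := by
  classical
  induction A using Finset.induction_on with
  | empty => simp
  | insert a A _ ih =>
    rw [Finset.sup_insert, DefinableSet.mem_sup, ih, mem_pointSet, Finset.mem_insert]

/-- Without parameters, a single point has only the trivial diagram, because there are no loops. -/
theorem tp_empty_eq_of_point (hU : IsRandomGraph U) (a b : U) :
    tp FirstOrder.Language.graph ∅ (fun _ : Fin 1 => a) =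
      tp FirstOrder.Language.graph ∅ (fun _ : Fin 1 => b) := by
  rw [tp_eq_iff]
  intro D hD
  obtain ⟨A₀, hA₀, h⟩ := hU.exists_isSupported_univ hD
  refine h.mem_iff ?_
  rintro (i | i)
  · exact absurd (hA₀ i.2) (notMem_empty _)
  · rintro (j | j)
    · exact absurd (hA₀ j.2) (notMem_empty _)
    · exact ⟨by simp, iff_of_false (hU.irrefl a) (hU.irrefl b)⟩

/-- By invariance all points have equal mass, and infinitely many points leave room only for mass
zero. -/
theorem IsAlbertMeasure.sup_pointSet (hU : IsRandomGraph U) {ν : Measure unitInterval}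
    {μ : KeislerMeasure FirstOrder.Language.graph (univ : Set U) (Fin 1)}
    (hμ : IsAlbertMeasure ν μ) (A : Finset U) : μ (A.sup pointSet) = 0 := by
  classical
  obtain ⟨a₀⟩ := ‹Nonempty U›
  have hc : ∀ a, μ (pointSet a) = μ (pointSet a₀) := fun a =>
    hμ.invariant 1 _ _ _ (tp_empty_eq_of_point hU a a₀)
  have hcard : ∀ A : Finset U, μ (A.sup pointSet) = A.card * μ (pointSet a₀) := by
    intro A
    induction A using Finset.induction_on with
    | empty =>
      have h := μ.map_sup ⊥ ⊥ disjoint_bot_left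
      rw [bot_sup_eq] at h
      simpa using h
    | insert a A ha ih =>
      rw [Finset.sup_insert, μ.map_sup, ih, hc, Finset.card_insert_of_notMem ha]
      · push_cast; ring
      · rw [disjoint_iff]
        refine Subtype.ext (Set.eq_empty_of_forall_notMem fun v hv => ?_)
        have h1 : v ∈ pointSet a := hv.1
        have h2 : v ∈ A.sup pointSet := hv.2
        rw [mem_pointSet] at h1
        rw [mem_sup_pointSet, h1] at h2
        exact ha h2
  have h0 : μ (pointSet a₀) = 0 := by
    by_contra hne
    obtain ⟨n, hn⟩ := exists_nat_gt (μ (pointSet a₀))⁻¹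
    have := hU.infinite
    obtain ⟨B, hB⟩ := Infinite.exists_subset_card_eq U n
    have h1 : μ (B.sup pointSet) ≤ 1 := by
      rw [← μ.map_top]; exact μ.mono le_top
    rw [hcard, hB] at h1
    have h2 := (inv_lt_iff_one_lt_mul₀ (pos_iff_ne_zero.2 hne)).1 hn
    rw [mul_comm] at h2
    exact absurd h1 (not_le.2 (by simpa [mul_comm] using h2))
  rw [hcard, h0, mul_zero]

theorem DefinableSet.disjoint_of_forall {L : FirstOrder.Language.{0, 0}} {V : Type u}
    [L.Structure V] {A : Set V} {α : Type*} {D E : L.DefinableSet A α}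
    (h : ∀ v, v ∈ D → v ∉ E) : Disjoint D E := by
  rw [disjoint_iff]
  exact Subtype.ext (Set.eq_empty_of_forall_notMem fun v hv => h v hv.1 hv.2)

/-- The values of `μ_ν` are bounded from below by the contributions of the two generic types. -/
theorem IsAlbertMeasure.lower_bound (hU : IsRandomGraph U) {r : unitInterval}
    {μ : KeislerMeasure FirstOrder.Language.graph (univ : Set U) (Fin 1)}
    (hμ : IsAlbertMeasure
      (ENNReal.ofReal r • Measure.dirac 1 + ENNReal.ofReal (1 - r) • Measure.dirac 0) μ)
    (D : FirstOrder.Language.graph.DefinableSet (univ : Set U) (Fin 1)) {p q : Prop}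
    [Decidable p] [Decidable q]
    (hp : p → GenericallyHolds (fun _ => true) {v : ℕ → U | v ∘ (Fin.val : Fin 1 → ℕ) ∈ D})
    (hq : q → GenericallyHolds (fun _ => false) {v : ℕ → U | v ∘ (Fin.val : Fin 1 → ℕ) ∈ D}) :
    (if p then (r : ℝ) else 0) + (if q then 1 - (r : ℝ) else 0) ≤ μ D := by
  classical
  obtain ⟨a₀⟩ := ‹Nonempty U›
  obtain ⟨A₀, -, hD⟩ := hU.exists_isSupported_univ D.2
  -- Nonemptiness of `A` makes the cones `E₁` and `E₀` disjoint and gives them mass `r` and `1 - r`.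
  obtain ⟨A, hA, hA₀⟩ : ∃ A : Finset U, A.Nonempty ∧ A₀ ⊆ A :=
    ⟨insert a₀ A₀, Finset.insert_nonempty _ _, Finset.subset_insert _ _⟩
  replace hD := hD.mono (Finset.coe_subset.2 hA₀) Subset.rfl
  have hD' : IsSupported {v : ℕ → U | v ∘ (Fin.val : Fin 1 → ℕ) ∈ (D : Set (Fin 1 → U))}
      (A : Set U) (Iio 1) := hD.preimage_comp _ fun i _ => i.2
  have hgen : ∀ c, GenericallyHolds (fun _ => c) {v : ℕ → U | v ∘ (Fin.val : Fin 1 → ℕ) ∈ D} →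
      ∀ v : Fin 1 → U, IsCoinGeneric c (A : Set U) (v 0) → v ∈ D := fun c h v hv => by
    have := (hD'.genericallyHolds_iff hU
      (isCoinSequence_one (ε := fun _ => c) (x := v 0) hv)).1 h
    have e : (fun _ : ℕ => v 0) ∘ (Fin.val : Fin 1 → ℕ) = v := by
      ext i; rw [Subsingleton.elim i 0]; rfl
    rw [mem_ofPred_eq, e] at this
    exact this
  set E₁ := A.inf adjSet
  set E₀ := A.inf (fun b => (adjSet b)ᶜ)
  have h1 : (μ E₁ : ℝ) = r := by
    have := hμ.eval A ∅ (Finset.disjoint_empty_right _)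
    rw [integral_endpoints] at this
    simpa [hA.card_ne_zero] using this
  have h0 : (μ E₀ : ℝ) = 1 - r := by
    have := hμ.eval ∅ A (Finset.disjoint_empty_left _)
    rw [integral_endpoints] at this
    simpa [hA.card_ne_zero] using this
  -- `E₀` may contain points of `A`, which are not generic; removing them costs nothing. `E₁`
  -- contains none, because such a point would be adjacent to itself.
  have h0' : μ (E₀ \ A.sup pointSet) = μ E₀ := by
    refine le_antisymm (μ.mono sdiff_le) ?_
    have := μ.map_sup_le (A.sup pointSet) (E₀ \ A.sup pointSet)
    rw [sup_sdiff_self_right, hμ.sup_pointSet hU, zero_add] at this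
    exact (μ.mono le_sup_right).trans this
  have hle1 : p → E₁ ≤ D := fun h v hv => hgen true (hp h) v <| by
    have hv' := mem_inf_adjSet.1 hv
    exact ⟨fun hm => hU.irrefl _ (hv' _ hm), fun b hb => iff_of_true (hv' b hb) rfl⟩
  have hle0 : q → E₀ \ A.sup pointSet ≤ D := fun h v hv => hgen false (hq h) v <| by
    have hv' := DefinableSet.mem_sdiff.1 hv
    rw [mem_inf_compl_adjSet, mem_sup_pointSet] at hv'
    exact ⟨hv'.2, fun b hb => iff_of_false (hv'.1 b hb) Bool.false_ne_true⟩
  have hdisj : Disjoint E₁ (E₀ \ A.sup pointSet) := by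
    refine DefinableSet.disjoint_of_forall fun v hv hv' => ?_
    obtain ⟨a, ha⟩ := hA
    exact mem_inf_compl_adjSet.1 (DefinableSet.mem_sdiff.1 hv').1 a ha (mem_inf_adjSet.1 hv a ha)
  by_cases hp' : p <;> by_cases hq' : q
  · rw [if_pos hp', if_pos hq', ← h0, ← h1, ← h0', ← NNReal.coe_add, ← μ.map_sup _ _ hdisj,
      NNReal.coe_le_coe]
    exact μ.mono (sup_le (hle1 hp') (hle0 hq'))
  · rw [if_pos hp', if_neg hq', ← h1, add_zero, NNReal.coe_le_coe]
    exact μ.mono (hle1 hp')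
  · rw [if_neg hp', if_pos hq', ← h0, ← h0', zero_add, NNReal.coe_le_coe]
    exact μ.mono (hle0 hq')
  · rw [if_neg hp', if_neg hq', zero_add]
    exact NNReal.coe_nonneg _

/-- Each of the two generic types contains `D` or its complement, so the two lower bounds add up to
`1` and both are equalities. -/
theorem IsAlbertMeasure.unique (hU : IsRandomGraph U) {r : unitInterval}
    {μ μ' : KeislerMeasure FirstOrder.Language.graph (univ : Set U) (Fin 1)}
    (hμ : IsAlbertMeasure
      (ENNReal.ofReal r • Measure.dirac 1 + ENNReal.ofReal (1 - r) • Measure.dirac 0) μ)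
    (hμ' : IsAlbertMeasure
      (ENNReal.ofReal r • Measure.dirac 1 + ENNReal.ofReal (1 - r) • Measure.dirac 0) μ') :
    μ = μ' := by
  classical
  refine KeislerMeasure.ext (funext fun D => ?_)
  have hcompl : ∀ c, ¬ GenericallyHolds (fun _ => c)
      {v : ℕ → U | v ∘ (Fin.val : Fin 1 → ℕ) ∈ D} → GenericallyHolds (fun _ => c)
      {v : ℕ → U | v ∘ (Fin.val : Fin 1 → ℕ) ∈ Dᶜ} := fun c h =>
    (genericallyHolds_or_compl hU _ (definable_comp Fin.val D)).resolve_left h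
  have key : ∀ {μ : KeislerMeasure FirstOrder.Language.graph (univ : Set U) (Fin 1)},
      IsAlbertMeasure
        (ENNReal.ofReal r • Measure.dirac 1 + ENNReal.ofReal (1 - r) • Measure.dirac 0) μ →
      (μ D : ℝ) = (if GenericallyHolds (fun _ => true)
        {v : ℕ → U | v ∘ (Fin.val : Fin 1 → ℕ) ∈ D} then (r : ℝ) else 0) +
        (if GenericallyHolds (fun _ => false)
        {v : ℕ → U | v ∘ (Fin.val : Fin 1 → ℕ) ∈ D} then 1 - (r : ℝ) else 0) := by
    intro μ hμ
    have h1 := hμ.lower_bound hU D id id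
    have h2 := hμ.lower_bound hU Dᶜ (hcompl true) (hcompl false)
    have h3 : (μ D : ℝ) + μ Dᶜ = 1 := by
      rw [← NNReal.coe_add, ← μ.map_sup _ _ disjoint_compl_right, sup_compl_eq_top, μ.map_top,
        NNReal.coe_one]
    simp only [ite_not] at h2
    split_ifs at h1 h2 ⊢ <;> linarith
  exact NNReal.coe_injective ((key hμ).trans (key hμ').symm)

end Albert

/-! ### Uniqueness of the sampling measure -/

section Uniqueness

variable {U : Type u} [FirstOrder.Language.graph.Structure U] [Nonempty U]

/-- Downward Löwenheim–Skolem for `M ∪ A₀`; uncountability of `κ` makes the result small. It ensures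
that the defining identity of the Morley product reaches every formula. -/
theorem exists_small_elementarySubstructure (hU : IsRandomGraph U) {κ : Cardinal.{u}}
    (hκ : ℵ₀ < κ) (M : FirstOrder.Language.graph.ElementarySubstructure U)
    (hM : (M : Set U).Countable) (A₀ : Finset U) :
    ∃ A' : FirstOrder.Language.graph.ElementarySubstructure U,
      M ≤ A' ∧ #A' < κ ∧ (A₀ : Set U) ⊆ A' := by
  have := hU.infinite
  have hc : ((M : Set U) ∪ A₀).Countable := hM.union A₀.countable_toSet
  obtain ⟨S, hS, hcard⟩ := exists_elementarySubstructure_card_eq FirstOrder.Language.graph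
    ((M : Set U) ∪ A₀) (ℵ₀ : Cardinal.{u}) le_rfl
    (Cardinal.lift_le.2 (Cardinal.le_aleph0_iff_set_countable.2 hc))
    (by
      have : Countable FirstOrder.Language.graph.Symbols :=
        have (l : ℕ) : Countable (FirstOrder.Language.graph.Functions l) :=
          inferInstanceAs (Countable Empty)
        inferInstanceAs (Countable ((Σ l, FirstOrder.Language.graph.Functions l) ⊕
          Σ l, FirstOrder.Language.graph.Relations l))
      have : FirstOrder.Language.graph.card ≤ ℵ₀ := Cardinal.mk_le_aleph0
      simpa using this) (by simp)
  refine ⟨S, fun x hx => hS (Or.inl hx), ?_, fun x hx => hS (Or.inr hx)⟩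
  rw [Cardinal.lift_inj] at hcard
  rw [hcard]
  exact hκ

theorem IsMorleyProduct.unique (hU : IsRandomGraph U) {κ : Cardinal.{u}}
    (hκ : ℵ₀ < κ) {M : FirstOrder.Language.graph.ElementarySubstructure U}
    (hM : (M : Set U).Countable) {α β : Type*}
    {μ : KeislerMeasure FirstOrder.Language.graph (univ : Set U) α}
    {ν : KeislerMeasure FirstOrder.Language.graph (univ : Set U) β}
    {ξ ξ' : KeislerMeasure FirstOrder.Language.graph (univ : Set U) (α ⊕ β)}
    (h : KeislerMeasure.IsMorleyProduct κ M μ ν ξ)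
    (h' : KeislerMeasure.IsMorleyProduct κ M μ ν ξ') : ξ = ξ' := by
  refine KeislerMeasure.ext (funext fun D => ?_)
  obtain ⟨A₀, -, hD⟩ := definable_iff_finitely_definable.1 D.2
  obtain ⟨A', hMA', hA', hA₀⟩ := exists_small_elementarySubstructure hU hκ M hM A₀
  exact NNReal.coe_injective ((h A' hMA' hA' ⟨D, hD.mono hA₀⟩).trans
    (h' A' hMA' hA' ⟨D, hD.mono hA₀⟩).symm)

theorem marginal_apply_cylinder {A : Set U} {α β γ : Type*}
    (P : KeislerMeasure FirstOrder.Language.graph A γ) (e : β → γ) (e' : α → β) {f : α → γ}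
    (hf : e ∘ e' = f) (D : FirstOrder.Language.graph.DefinableSet A α) :
    P.marginal f D = P.marginal e (cylinder e' D) := by
  subst hf
  rfl

theorem IsSamplingMeasure.unique (hU : IsRandomGraph U) {κ : Cardinal.{u}}
    (hκ : ℵ₀ < κ) {M : FirstOrder.Language.graph.ElementarySubstructure U}
    (hM : (M : Set U).Countable)
    {μ : KeislerMeasure FirstOrder.Language.graph (univ : Set U) (Fin 1)}
    {P P' : KeislerMeasure FirstOrder.Language.graph (univ : Set U) ℕ}
    (h : KeislerMeasure.IsSamplingMeasure κ M μ P)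
    (h' : KeislerMeasure.IsSamplingMeasure κ M μ P') : P = P' := by
  have hmarg : ∀ n : ℕ, P.marginal (Fin.val : Fin (n + 1) → ℕ) =
      P'.marginal (Fin.val : Fin (n + 1) → ℕ) := by
    intro n
    induction n with
    | zero => exact h.base.trans h'.base.symm
    | succ n ih =>
      have h1 := h.step (n + 1) n.succ_pos
      rw [ih] at h1
      have h2 := IsMorleyProduct.unique hU hκ hM h1 (h'.step (n + 1) n.succ_pos)
      refine KeislerMeasure.ext (funext fun D => ?_)
      -- The last variable becomes the left factor of the Morley product, the others the right
      -- factor.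
      let e' : Fin (n + 1 + 1) → Fin 1 ⊕ Fin (n + 1) :=
        Fin.lastCases (Sum.inl 0) Sum.inr
      have he : Sum.elim (fun _ : Fin 1 => n + 1) (Fin.val : Fin (n + 1) → ℕ) ∘ e' =
          (Fin.val : Fin (n + 1 + 1) → ℕ) := by
        ext i
        refine Fin.lastCases ?_ (fun j => ?_) i
        · simp [e']
        · simp [e']
      have h3 := marginal_apply_cylinder P _ e' he D
      have h4 := marginal_apply_cylinder P' _ e' he D
      rw [h2] at h3
      exact h3.trans h4.symm
  refine KeislerMeasure.ext (funext fun D => ?_)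
  obtain ⟨A₀, n, -, hD⟩ := hU.exists_isSupported_nat D.2
  -- Only the variables below `n` matter, so truncating indices at `n` leaves `D` unchanged; `Fin (n
  -- + 1)` avoids an empty index set.
  let g : ℕ → Fin (n + 1) := fun i => ⟨min i n, Nat.lt_succ_of_le (min_le_right _ _)⟩
  have hg : cylinder (Fin.val : Fin (n + 1) → ℕ) (cylinder g D) = D := by
    refine Subtype.ext (Set.ext fun v => hD _ _ ?_)
    have : (fun i : Iio n => (v ∘ Fin.val ∘ g) i) = fun i : Iio n => v i := by
      ext i
      simp [g, (mem_Iio.1 i.2).le]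
    intro i j
    change (Sum.elim _ (fun i : Iio n => (v ∘ Fin.val ∘ g) i) i =
      Sum.elim _ (fun i : Iio n => (v ∘ Fin.val ∘ g) i) j ↔ _) ∧
      (Edge (Sum.elim _ (fun i : Iio n => (v ∘ Fin.val ∘ g) i) i)
        (Sum.elim _ (fun i : Iio n => (v ∘ Fin.val ∘ g) i) j) ↔ _)
    rw [this]
    exact ⟨Iff.rfl, Iff.rfl⟩
  rw [← hg]
  exact congrArg (fun Q : KeislerMeasure FirstOrder.Language.graph (univ : Set U) (Fin (n + 1)) =>
    Q (cylinder g D)) (hmarg n)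

end Uniqueness

/-! ### The sampled structures -/

section Sampled

theorem relMap_eq_edge {V : Type*} (S : FirstOrder.Language.graph.Structure V) (x : Fin 2 → V) :
    S.RelMap adj x ↔ S.RelMap adj ![x 0, x 1] := by
  have : x = ![x 0, x 1] := by
    ext i; fin_cases i <;> rfl
  rw [← this]

theorem str_ext {S S' : Str FirstOrder.Language.graph}
    (h : ∀ i j : ℕ, S.RelMap adj ![i, j] ↔ S'.RelMap adj ![i, j]) : S = S' := by
  refine FirstOrder.Language.Structure.ext ?_ ?_
  · funext n f
    exact isEmptyElim f
  · funext n R x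
    cases R
    exact propext ((relMap_eq_edge S x).trans ((h _ _).trans (relMap_eq_edge S' x).symm))

/-- Ensures that the compact set of threshold structures is closed, hence Borel. -/
instance : T2Space (Str FirstOrder.Language.graph) := by
  refine ⟨fun S S' hne => ?_⟩
  have : ∃ i j : ℕ, ¬ (S.RelMap adj ![i, j] ↔ S'.RelMap adj ![i, j]) := by
    by_contra! h
    exact hne (str_ext h)
  obtain ⟨i, j, hij⟩ := this
  have h1 : IsOpen (Str.relSet (L := FirstOrder.Language.graph) adj ![i, j]) :=
    TopologicalSpace.isOpen_generateFrom_of_mem ⟨2, adj, _, Or.inl rfl⟩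
  have h2 : IsOpen (Str.relSet (L := FirstOrder.Language.graph) adj ![i, j])ᶜ :=
    TopologicalSpace.isOpen_generateFrom_of_mem ⟨2, adj, _, Or.inr rfl⟩
  by_cases h : S.RelMap adj ![i, j]
  · exact ⟨_, _, h1, h2, h, fun h' => hij (iff_of_true h h'), disjoint_compl_right⟩
  · refine ⟨_, _, h2, h1, h, ?_, disjoint_compl_left⟩
    by_contra h'
    exact hij (iff_of_false h h')

variable {U : Type u} [FirstOrder.Language.graph.Structure U]

theorem continuous_labeledStructure : Continuous
    (labeledStructure : TypeSpace FirstOrder.Language.graph (univ : Set U) ℕ → _) := by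
  refine continuous_generateFrom_iff.2 ?_
  rintro _ ⟨n, R, i, rfl | rfl⟩
  · exact CompleteType.isOpen_typesWith _
  · exact (CompleteType.isClosed_typesWith _).isOpen_compl

theorem isClosed_nondegenerateTypes :
    IsClosed (nondegenerateTypes FirstOrder.Language.graph U) := by
  have h1 : IsClosed {p : TypeSpace FirstOrder.Language.graph (univ : Set U) ℕ |
      ∀ i j : ℕ, i ≠ j → Formula.equivSentence (∼(Term.equal (Term.var i) (Term.var j)) :
        FirstOrder.Language.graph[[(univ : Set U)]].Formula ℕ) ∈ p} := by
    simp only [Set.ofPred_forall]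
    exact isClosed_iInter fun i => isClosed_iInter fun j => isClosed_iInter fun _ =>
      CompleteType.isClosed_typesWith _
  have h2 : IsClosed {p : TypeSpace FirstOrder.Language.graph (univ : Set U) ℕ |
      ∀ (i : ℕ) (a : (univ : Set U)), Formula.equivSentence (Term.equal (Term.var i)
        (FirstOrder.Language.graph.con a).term :
          FirstOrder.Language.graph[[(univ : Set U)]].Formula ℕ) ∉ p} := by
    simp only [Set.ofPred_forall]
    exact isClosed_iInter fun i => isClosed_iInter fun a =>
      (CompleteType.isOpen_typesWith _).isClosed_compl
  exact h1.inter h2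

variable [Nonempty U]

theorem IsCoinSequence.edge_iff (hU : IsRandomGraph U) {ε : ℕ → Bool} {A : Set U} {n : ℕ}
    {v : ℕ → U} (hv : IsCoinSequence ε A n v) {i j : ℕ} (hi : i < n) (hj : j < n) :
    Edge (v i) (v j) ↔ (thresholdGraph ε).Adj i j := by
  have key : ∀ {i j}, i < j → j < n → (Edge (v j) (v i) ↔ (thresholdGraph ε).Adj i j) :=
    fun {i j} hij hj => by
      rw [thresholdGraph_adj_of_lt hij]
      exact (hv j hj).2 _ (Or.inr ⟨i, hij, rfl⟩)
  rcases lt_trichotomy i j with h | rfl | h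
  · rw [hU.edge_comm]; exact key h hj
  · exact iff_of_false (hU.irrefl _) ((thresholdGraph ε).irrefl)
  · rw [SimpleGraph.adj_comm]; exact key h hi

theorem genericallyHolds_iff_of_forall (hU : IsRandomGraph U) {ε : ℕ → Bool} {D : Set (ℕ → U)}
    {p : Prop} {A : Finset U} {n : ℕ}
    (h : ∀ v, IsCoinSequence ε (A : Set U) n v → (v ∈ D ↔ p)) : GenericallyHolds ε D ↔ p := by
  refine ⟨fun hD => ?_, fun hp => ⟨A, n, fun v hv => (h v hv).2 hp⟩⟩
  have h' : GenericallyHolds ε {v : ℕ → U | IsCoinSequence ε (A : Set U) n v} :=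
    ⟨A, n, fun v hv => hv⟩
  obtain ⟨v, hv, hv'⟩ := (hD.inter h').nonempty hU
  exact (h v hv').1 hv

theorem coinType_mem_nondegenerateTypes (hU : IsRandomGraph U) (ε : ℕ → Bool) :
    coinType hU univ id ε ∈ nondegenerateTypes FirstOrder.Language.graph U := by
  constructor
  · intro i j hij
    rw [equivSentence_mem_coinType, genericallyHolds_iff_of_forall hU (p := True) (A := ∅)
      (n := max i j + 1)]
    · trivial
    · intro v hv
      simp only [iff_true, mem_ofPred_eq, Function.comp_id, Formula.realize_not,
        Formula.realize_equal, Term.realize_var]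
      rcases lt_or_gt_of_ne hij with h | h
      · exact fun e => (hv j (Nat.lt_succ_of_le (le_max_right _ _))).1 (Or.inr ⟨i, h, e⟩)
      · exact fun e => (hv i (Nat.lt_succ_of_le (le_max_left _ _))).1 (Or.inr ⟨j, h, e.symm⟩)
  · intro i a
    rw [equivSentence_mem_coinType, genericallyHolds_iff_of_forall hU (p := False)
      (A := {(a : U)}) (n := i + 1)]
    · exact id
    · intro v hv
      simp only [iff_false, mem_ofPred_eq, Function.comp_id, Formula.realize_equal,
        Term.realize_var, Term.realize_con]
      exact fun e => (hv i i.lt_succ_self).1 (Or.inl (by simpa using e))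

theorem labeledStructure_coinType (hU : IsRandomGraph U) (ε : ℕ → Bool) :
    labeledStructure (coinType hU univ id ε) = thresholdStr ε := by
  refine str_ext fun i j => ?_
  change Formula.equivSentence _ ∈ coinType hU univ id ε ↔ (thresholdGraph ε).Adj i j
  rw [equivSentence_mem_coinType]
  refine genericallyHolds_iff_of_forall hU (A := ∅) (n := max i j + 1) fun v hv => ?_
  rw [← hv.edge_iff hU (Nat.lt_succ_of_le (le_max_left i j)) (Nat.lt_succ_of_le (le_max_right i j))]
  simp only [mem_ofPred_eq, Function.comp_id, Formula.realize_rel, LHom.map_onRelation]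
  have : (fun k => Term.realize v (Term.var (![i, j] k) :
      FirstOrder.Language.graph[[(univ : Set U)]].Term ℕ)) = ![v i, v j] := by
    ext k; fin_cases k <;> rfl
  rw [this]

variable (U) in
theorem continuous_thresholdStr (hU : IsRandomGraph U) : Continuous thresholdStr := by
  have : thresholdStr = labeledStructure ∘ coinType hU univ id :=
    funext fun ε => (labeledStructure_coinType hU ε).symm
  rw [this]
  exact continuous_labeledStructure.comp (continuous_coinType hU _ _)

/-- Every coin type is nondegenerate, so the restriction loses no mass, and its labeled structure is
the threshold graph of its coins. -/
theorem pushforward_coinKeisler (hU : IsRandomGraph U) (r : unitInterval) :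
    pushforward (coinKeisler hU r).toMeasure = (coinMeasure r).map thresholdStr := by
  have hm := (continuous_coinType hU (univ : Set U) (id : ℕ → ℕ)).measurable
  have hg := (continuous_labeledStructure (U := U)).measurable
  rw [pushforward, coinKeisler_toMeasure,
    Measure.restrict_map hm isClosed_nondegenerateTypes.measurableSet, Measure.map_map hg hm]
  have h1 : coinType hU (univ : Set U) (id : ℕ → ℕ) ⁻¹'
      nondegenerateTypes FirstOrder.Language.graph U = Set.univ :=
    eq_univ_of_forall fun ε => coinType_mem_nondegenerateTypes hU ε
  have h2 : labeledStructure ∘ coinType hU univ id = thresholdStr :=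
    funext fun ε => labeledStructure_coinType hU ε
  rw [h1, Measure.restrict_univ, h2]

/-! ### Null isomorphism classes and failure of exchangeability -/

/-- The structure induced on a realization of `p` is isomorphic to the labeled structure of `p`. -/
theorem exists_bijection_of_mem_isoTypes {N : Type w} [FirstOrder.Language.graph.Structure N]
    {p : TypeSpace FirstOrder.Language.graph (univ : Set U) ℕ}
    (hp : p ∈ isoTypes FirstOrder.Language.graph U N) :
    ∃ f : ℕ → N, Function.Bijective f ∧ ∀ i j : ℕ,
      ((labeledStructure p).RelMap adj ![i, j] ↔ Edge (f i) (f j)) := by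
  obtain ⟨hp, U', a, hap, e, he⟩ := hp
  have hinj : Function.Injective a := by
    intro i j hij
    by_contra hne
    have := hp.1 i j hne
    rw [← hap, Theory.CompleteType.formula_mem_typeOf, Formula.realize_not,
      Formula.realize_equal] at this
    exact this hij
  have hrel : ∀ i j : ℕ, ((labeledStructure p).RelMap adj ![i, j] ↔
      Structure.RelMap ((FirstOrder.Language.graph.lhomWithConstants (univ : Set U)).onRelation adj)
        ![a i, a j]) := by
    intro i j
    change Formula.equivSentence _ ∈ p ↔ _
    rw [← hap, Theory.CompleteType.formula_mem_typeOf, Formula.realize_rel]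
    have : (fun k => Term.realize a (Term.var (![i, j] k) :
        FirstOrder.Language.graph[[(univ : Set U)]].Term ℕ)) = ![a i, a j] := by
      ext k; fin_cases k <;> rfl
    rw [this]
  let : FirstOrder.Language.graph.Structure U' :=
    (FirstOrder.Language.graph.lhomWithConstants (univ : Set U)).reduct U'
  have hex : ∀ i, ∃ x, e x = a i := fun i => by
    have : a i ∈ range e := he ▸ ⟨i, rfl⟩
    exact this
  choose f hf using hex
  refine ⟨f, ⟨fun i j hij => hinj ?_, fun x => ?_⟩, fun i j => ?_⟩
  · rw [← hf i, ← hf j, hij]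
  · have : e x ∈ range a := he ▸ ⟨x, rfl⟩
    obtain ⟨i, hi⟩ := this
    exact ⟨i, e.injective ((hf i).trans hi)⟩
  · rw [hrel, ← hf i, ← hf j]
    have h := e.map_rel adj ![f i, f j]
    have h' : e ∘ ![f i, f j] = ![e (f i), e (f j)] := by
      ext k; fin_cases k <;> rfl
    rw [h'] at h
    exact h

/-- Any `n` prescribed coins occur with probability at most `c ^ n`, where `c = max r (1 - r) < 1`.
-/
theorem coinMeasure_eq_tail (r : unitInterval) (hr0 : 0 < r) (hr1 : r < 1) (δ : ℕ → Bool) :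
    coinMeasure r {ε | ∀ k, ε (k + 1) = δ (k + 1)} = 0 := by
  let c : ℝ≥0∞ := max (unitInterval.toNNReal r) (unitInterval.toNNReal (unitInterval.symm r))
  have hc : c < 1 := by
    refine max_lt ?_ ?_
    · rw [ENNReal.coe_lt_one_iff, ← NNReal.coe_lt_coe]
      exact hr1
    · rw [ENNReal.coe_lt_one_iff, ← NNReal.coe_lt_coe]
      have : (0 : ℝ) < r := hr0
      change (1 - (r : ℝ)) < 1
      linarith
  have hb : ∀ b : Bool, ProbabilityTheory.bernoulliMeasure true false r {b} ≤ c := by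
    intro b
    rw [ProbabilityTheory.bernoulliMeasure_apply _ .of_discrete]
    cases b
    · simp [c]
    · simp [c]
  have hle : ∀ n : ℕ, coinMeasure r {ε | ∀ k, ε (k + 1) = δ (k + 1)} ≤ c ^ n := by
    intro n
    calc coinMeasure r {ε | ∀ k, ε (k + 1) = δ (k + 1)}
        ≤ coinMeasure r (Set.pi (((Finset.range n).map ⟨_, Nat.succ_injective⟩ : Finset ℕ) : Set ℕ)
          fun i => {δ i}) := by
          refine measure_mono fun ε hε i hi => ?_
          obtain ⟨k, -, rfl⟩ := Finset.mem_map.1 (Finset.mem_coe.1 hi)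
          exact hε k
      _ = ∏ i ∈ (Finset.range n).map ⟨_, Nat.succ_injective⟩,
          ProbabilityTheory.bernoulliMeasure true false r {δ i} :=
          Measure.infinitePi_pi _ fun i _ => .of_discrete
      _ ≤ c ^ n := by
          rw [Finset.prod_map]
          exact (Finset.prod_le_pow_card _ _ _ fun i _ => hb _).trans (by simp)
  exact le_antisymm (ge_of_tendsto' (ENNReal.tendsto_pow_atTop_nhds_zero_of_lt_one hc) hle)
    bot_le

/-- All coin types in the class share their coins at positive indices. Measurability of the class is
not needed: it lies in the union of the complement of the compact range of `coinType` and the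
compact image of one tail class. -/
theorem coinKeisler_isoTypes (hU : IsRandomGraph U) {r : unitInterval} (hr0 : 0 < r) (hr1 : r < 1)
    (N : Type w) [FirstOrder.Language.graph.Structure N] :
    (coinKeisler hU r).toMeasure (isoTypes FirstOrder.Language.graph U N) = 0 := by
  have hcont := continuous_coinType hU (univ : Set U) (id : ℕ → ℕ)
  rw [coinKeisler_toMeasure]
  by_cases hN : ∃ δ, coinType hU univ id δ ∈ isoTypes FirstOrder.Language.graph U N
  swap
  · have hr : MeasurableSet (range (coinType hU (univ : Set U) (id : ℕ → ℕ))) :=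
      (isCompact_range hcont).isClosed.measurableSet
    refine measure_mono_null (t := (range (coinType hU univ id))ᶜ) ?_ ?_
    · rintro _ hp ⟨δ, rfl⟩
      exact hN ⟨δ, hp⟩
    · rw [Measure.map_apply hcont.measurable hr.compl, preimage_compl, preimage_range,
        compl_univ, measure_empty]
  obtain ⟨δ, hδ⟩ := hN
  obtain ⟨g, hg, hg'⟩ := exists_bijection_of_mem_isoTypes hδ
  rw [labeledStructure_coinType] at hg'
  set C : Set (ℕ → Bool) := {ε | ∀ k, ε (k + 1) = δ (k + 1)} with hC
  have hCc : IsClosed C := by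
    simp only [hC, Set.ofPred_forall]
    exact isClosed_iInter fun k => isClosed_eq (by fun_prop) (by fun_prop)
  have hm : MeasurableSet ((range (coinType hU (univ : Set U) (id : ℕ → ℕ)))ᶜ ∪
      coinType hU (univ : Set U) (id : ℕ → ℕ) '' C) :=
    (isCompact_range hcont).isClosed.measurableSet.compl.union
      (hCc.isCompact.image hcont).isClosed.measurableSet
  refine measure_mono_null (t := (range (coinType hU univ id))ᶜ ∪ coinType hU univ id '' C) ?_ ?_
  · intro p hp
    refine or_iff_not_imp_left.2 fun h => ?_
    obtain ⟨ε, rfl⟩ := not_not.1 h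
    obtain ⟨f, hf, hf'⟩ := exists_bijection_of_mem_isoTypes hp
    rw [labeledStructure_coinType] at hf'
    refine ⟨ε, fun k => ?_, rfl⟩
    let e := Equiv.ofBijective g hg
    have he : ∀ x, g (e.symm x) = x := fun x => e.apply_symm_apply x
    refine eq_of_thresholdGraph_iso k (f := e.symm ∘ f) (e.symm.bijective.comp hf) fun i j => ?_
    refine (hf' i j).trans (Iff.trans ?_ (hg' (e.symm (f i)) (e.symm (f j))).symm)
    rw [he, he]
  · rw [Measure.map_apply hcont.measurable hm]
    refine measure_mono_null ?_ (coinMeasure_eq_tail r hr0 hr1 δ)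
    -- Equal coin types have equal labeled structures, and the edges at `0` recover the coins at
    -- positive indices.
    rintro ε (h | ⟨ε', hε', h⟩)
    · exact absurd ⟨ε, rfl⟩ h
    · have h' := congrArg labeledStructure h
      rw [labeledStructure_coinType, labeledStructure_coinType] at h'
      intro k
      have hk : (thresholdGraph ε').Adj 0 (k + 1) ↔ (thresholdGraph ε).Adj 0 (k + 1) := by
        change (thresholdStr ε').RelMap adj ![0, k + 1] ↔ (thresholdStr ε).RelMap adj ![0, k + 1]
        rw [h']
      rw [thresholdGraph_adj_of_lt k.succ_pos, thresholdGraph_adj_of_lt k.succ_pos] at hk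
      exact (Bool.eq_iff_iff.2 hk).symm.trans (hε' k)

theorem measurableSet_relSet (i j : ℕ) :
    MeasurableSet (Str.relSet (L := FirstOrder.Language.graph) adj ![i, j]) :=
  (TopologicalSpace.isOpen_generateFrom_of_mem ⟨2, adj, _, Or.inl rfl⟩ :
    IsOpen (Str.relSet (L := FirstOrder.Language.graph) adj ![i, j])).measurableSet

/-- The event that `0` is adjacent to `1` but not to `2` only asks for two different coins. Swapping
`0` and `2` yields an impossible event: `2` is adjacent to `1` but not to `0`, although coin `2`
decides both edges. -/
theorem not_isSymInvariant_threshold (h : Measurable thresholdStr) {r : unitInterval}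
    (hr0 : 0 < r) (hr1 : r < 1) : ¬ IsSymInvariant ((coinMeasure r).map thresholdStr) := by
  intro hinv
  have hb : ∀ b : Bool, ProbabilityTheory.bernoulliMeasure true false r {b} ≠ 0 := by
    intro b
    rw [ProbabilityTheory.bernoulliMeasure_apply _ .of_discrete, ← pos_iff_ne_zero]
    cases b
    · simpa [← NNReal.coe_pos] using hr1
    · simpa [← NNReal.coe_pos] using hr0
  have hB : MeasurableSet (Str.relSet (L := FirstOrder.Language.graph) adj ![0, 1] ∩
      (Str.relSet adj ![0, 2])ᶜ) := (measurableSet_relSet 0 1).inter (measurableSet_relSet 0 2).compl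
  have hB' : MeasurableSet (Str.relSet (L := FirstOrder.Language.graph) adj ![2, 1] ∩
      (Str.relSet adj ![2, 0])ᶜ) := (measurableSet_relSet 2 1).inter (measurableSet_relSet 2 0).compl
  have h1 := hinv _ hB (Equiv.swap 0 2)
  have h2 : (coinMeasure r).map thresholdStr (Str.permute (Equiv.swap 0 2) ''
      (Str.relSet (L := FirstOrder.Language.graph) adj ![0, 1] ∩ (Str.relSet adj ![0, 2])ᶜ)) = 0 := by
    refine measure_mono_null (t := Str.relSet (L := FirstOrder.Language.graph) adj ![2, 1] ∩
      (Str.relSet adj ![2, 0])ᶜ) ?_ ?_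
    · rintro _ ⟨S, ⟨hS1, hS2⟩, rfl⟩
      have e : ∀ i j : ℕ, (Str.permute (Equiv.swap 0 2) S).RelMap adj ![i, j] ↔
          S.RelMap adj ![Equiv.swap 0 2 i, Equiv.swap 0 2 j] := fun i j => by
        exact relMap_eq_edge S ((Equiv.swap 0 2).symm ∘ ![i, j])
      refine ⟨(e 2 1).2 ?_, fun h => hS2 ?_⟩
      · have h1 : Equiv.swap 0 2 1 = 1 := by decide
        rw [h1, Equiv.swap_apply_right]
        exact hS1
      · have := (e 2 0).1 h
        rw [Equiv.swap_apply_left, Equiv.swap_apply_right] at this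
        exact this
    · rw [Measure.map_apply h hB']
      convert measure_empty (μ := coinMeasure r)
      refine Set.eq_empty_of_forall_notMem fun ε hε => hε.2 ?_
      have h3 : (thresholdGraph ε).Adj 2 1 := hε.1
      change (thresholdGraph ε).Adj 2 0
      rw [SimpleGraph.adj_comm, thresholdGraph_adj_of_lt (by norm_num)] at h3 ⊢
      exact h3
  rw [h2, Measure.map_apply h hB] at h1
  -- The event prescribes coin `1` as true and coin `2` as false, so its probability is a product of
  -- two nonzero factors.
  have h4 : thresholdStr ⁻¹' (Str.relSet (L := FirstOrder.Language.graph) adj ![0, 1] ∩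
      (Str.relSet adj ![0, 2])ᶜ) =
      Set.pi (({1, 2} : Finset ℕ) : Set ℕ) fun i => {decide (i = 1)} := by
    ext ε
    change ((thresholdGraph ε).Adj 0 1 ∧ ¬ (thresholdGraph ε).Adj 0 2) ↔ _
    rw [thresholdGraph_adj_of_lt (by norm_num), thresholdGraph_adj_of_lt (by norm_num)]
    simp
  rw [h4, Measure.infinitePi_pi _ fun i _ => .of_discrete,
    Finset.prod_pair (by norm_num), mul_eq_zero] at h1
  exact h1.elim (hb _) (hb _)

theorem ae_exists_eq_thresholdStr (h : Continuous thresholdStr) (m : Measure (ℕ → Bool)) :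
    ∀ᵐ S ∂(m.map thresholdStr), ∃ ε : ℕ → Bool, S = thresholdStr ε := by
  have hr : MeasurableSet {S | ∃ ε : ℕ → Bool, S = thresholdStr ε} := by
    have : {S | ∃ ε : ℕ → Bool, S = thresholdStr ε} = range thresholdStr := by
      ext S; simp [eq_comm]
    rw [this]
    exact (isCompact_range h).isClosed.measurableSet
  rw [ae_map_iff h.measurable.aemeasurable hr]
  exact Filter.Eventually.of_forall fun ε => ⟨ε, rfl⟩

end Sampled

end GenericSampling

end

theorem mainTheorem12 {U : Type u} [FirstOrder.Language.graph.Structure U] [Nonempty U]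
    (κ : Cardinal.{u}) (hκ : ℵ₀ < κ) (hU : IsMonsterModel κ radoTheory U)
    (M : FirstOrder.Language.graph.ElementarySubstructure U) (hM : (M : Set U).Countable)
    (r : unitInterval) (hr0 : 0 < r) (hr1 : r < 1) (ν : Measure unitInterval)
    (hν : ν = ENNReal.ofReal r • Measure.dirac 1 + ENNReal.ofReal (1 - r) • Measure.dirac 0) :
    -- the Keisler measure `μ = μ_ν` exists, is unique, and is Borel-definable over `M`
    ∃ μ : KeislerMeasure FirstOrder.Language.graph (univ : Set U) (Fin 1),
      (IsAlbertMeasure ν μ ∧ ∀ μ', IsAlbertMeasure ν μ' → μ' = μ) ∧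
      μ.IsBorelDefinable (M : Set U) ∧
      -- the Keisler measure `P = ℙ_μ` exists and is unique
      ∃ P : KeislerMeasure FirstOrder.Language.graph (univ : Set U) ℕ,
        (KeislerMeasure.IsSamplingMeasure κ M μ P ∧
          ∀ P', KeislerMeasure.IsSamplingMeasure κ M μ P' → P' = P) ∧
        (∀ (N : Type w) [FirstOrder.Language.graph.Structure N],
          P.toMeasure (isoTypes FirstOrder.Language.graph U N) = 0) ∧
        ¬ IsSymInvariant (pushforward P.toMeasure) ∧
        -- the sampled graph is a threshold graph, and its coins are independent with parameter `r`
        (∀ᵐ S ∂(pushforward P.toMeasure), ∃ ε : ℕ → Bool, S = thresholdStr ε) ∧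
        pushforward P.toMeasure =
          (Measure.infinitePi (fun _ : ℕ =>
            ProbabilityTheory.bernoulliMeasure true false r)).map thresholdStr := by
  have hR := isRandomGraph_of_model hU.model
  subst hν
  have hμ := isAlbertMeasure_coinKeisler₁ hR r
  have hMκ : #(M : Set U) < κ := (Cardinal.le_aleph0_iff_set_countable.2 hM).trans_lt hκ
  refine ⟨coinKeisler₁ hR r, ⟨hμ, fun μ' hμ' => hμ'.unique hR hμ⟩,
    coinKeisler₁_isBorelDefinable hR r (hU.saturated _ hMκ), coinKeisler hR r, ?_, ?_⟩
  · have hP : KeislerMeasure.IsSamplingMeasure κ M (coinKeisler₁ hR r) (coinKeisler hR r) :=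
      -- The base case is definitional: the one-variable measure was introduced as the first
      -- marginal.
      ⟨rfl, fun n _ => coinKeisler_isMorleyProduct hR r hU.saturated M n⟩
    exact ⟨hP, fun P' hP' => IsSamplingMeasure.unique hR hκ hM hP' hP⟩
  · have hcont := continuous_thresholdStr U hR
    rw [pushforward_coinKeisler]
    exact ⟨fun N _ => coinKeisler_isoTypes hR hr0 hr1 N,
      not_isSymInvariant_threshold hcont.measurable hr0 hr1,
      ae_exists_eq_thresholdStr hcont _, rfl⟩
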